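/- Let $\zeta$ be the Riemann zeta-function and $c$ Euler's constant. For every $T>0$ the function $t\mapsto \ln t-|\zeta(\tfrac12+it)|^2$ is integrable on $(0,T)$, and for every real $q>0$ the limit $$L(q)=\lim_{\tau\to\infty}\frac1\tau\int_0^{\frac{q\tau}{\ln(2\pi)-2c}}\left\{\ln t-\left|\zeta\left(\tfrac12+it\right)\right|^2\right\}dt$$ exists and equals $q$. Moreover, the condition $$L\left(\frac{x^n+y^n}{z^n}\right)\neq 1\quad\text{for all positive integers } x,y,z \text{ and all integers } n\ge 3$$ is equivalent to the Fermat--Wiles theorem, that is, to the assertion that $x^n+y^n\ne z^n$ for all positive integers $x,y,z$ and all integers $n\geq 3$. -/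

import Mathlib

open Filter Topology MeasureTheory

noncomputable section

/-- The integrand `ln t - |ζ(1/2 + it)|²`. -/
def logZetaIntegrand (t : ℝ) : ℝ :=
  Real.log t - ‖riemannZeta (1 / 2 + (t : ℂ) * Complex.I)‖ ^ 2

/-- The logarithmic modification of the Hardy-Littlewood integral,
`J₁(T) = ∫₀ᵀ (ln t - |ζ(1/2 + it)|²) dt`. -/
def logHardyLittlewood (T : ℝ) : ℝ :=
  ∫ t in (0 : ℝ)..T, logZetaIntegrand t

/-- `(1/τ) J₁(q τ / (ln 2π - 2c))`, with `c` Euler's constant. -/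
def normalizedLogHardyLittlewood (q τ : ℝ) : ℝ :=
  (1 / τ) * logHardyLittlewood
    (q * (τ / (Real.log (2 * Real.pi) - 2 * Real.eulerMascheroniConstant)))

/-- `HasL q l`: the limit `L(q) = lim_{τ → ∞} (1/τ) J₁(q τ / (ln 2π - 2c))` exists and equals
`l`. -/
def HasL (q l : ℝ) : Prop :=
  Tendsto (normalizedLogHardyLittlewood q) atTop (𝓝 l)

end

/-!
The heart of the matter is the classical mean value theorem
`∫₀ᵀ |ζ(1/2 + it)|² dt = T log T + (2γ - 1 - log (2π)) T + o(T)`. Since `∫₀ᵀ log t dt = T log T - T`,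
it says that the integral of `log t - |ζ(1/2 + it)|²` over `(0, T)` is asymptotic to
`(log (2π) - 2γ) T`, hence `L(q) = q` (`hasL_self`). The equivalence with Fermat's equation is then
formal: `L((xⁿ + yⁿ) / zⁿ) ≠ 1` literally says `xⁿ + yⁿ ≠ zⁿ`.

The mean value is obtained without an approximate functional equation, from the elementary theory of
the fractional part. In the critical strip `-ζ(s) / s` is the Mellin transform of `fract (1 / x)`
(`mellin_fract_inv`), so Parseval's formula turns the quadratic mean of the increments
`fract ((1 + h) y) - fract y` into an integral of `|ζ(s) / s|²` against a cosine kernel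
(`integral_fractIncrSq_eq`). That quadratic mean can be computed up to `O(h²)`
(`abs_integral_fractIncrSq_sub_le`): for `y < 1 / h` the increments are explicit and sum to a harmonic
number, and for `y > 1 / h` they equidistribute, the average being a constant that Stirling's formula
gives. With `h = exp u - 1` the result is
`∫ |ζ(s) / s|² (1 - cos (t u)) dt = π u (-log u + γ + 1 - log (2π)) + O(u²)` for all `u > 0`
(`exists_abs_zetaCosTransform_sub_le`).

Multiplying the Laplace transform of this relation at `H + ia` by `(H + ia)²` and taking real parts
gives the means of `t² |ζ(s) / s|²` against Poisson kernels of width `H` centred at `a`, with error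
`O((a² + H²) / H³)` (`exists_abs_poisson_mean_sub_le`). The error term `O(u²)` above is strong enough
for widths `H` much smaller than `|a|`. Integrating over `a ∈ [-T, T]` yields the mean square with
a smooth cut-off of width `H`, and since the integrand is nonnegative, a sandwich between two such
cut-offs, shifted by `L` with `H < L < T`, yields the sharp one (`exists_abs_dampedMeanSq_sub_le`).
-/

/-! ### Plancherel's theorem and the Mellin transform -/

section Plancherel

open scoped FourierTransform ContDiff

/-- On `L¹ ∩ L²` the Fourier transform defined by the integral is the one that Mathlib extends from
Schwartz functions to `L²`: both represent the same tempered distribution. -/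
theorem coeFn_fourier_toLp_ae_eq {f : ℝ → ℂ} (hf : Integrable f) (hf2 : MemLp f 2) :
    ((𝓕 (hf2.toLp f) : Lp ℂ 2 (volume : Measure ℝ)) : ℝ → ℂ) =ᵐ[volume] 𝓕 f := by
  have hcont : Continuous (𝓕 f) :=
    VectorFourier.fourierIntegral_continuous Real.continuous_fourierChar
      (by fun_prop) hf
  refine ae_eq_of_integral_contDiff_smul_eq
    ((Lp.memLp _).locallyIntegrable (by norm_num)) hcont.locallyIntegrable ?_
  intro g hg hgs
  have hg' : ContDiff ℝ ∞ (fun x => (g x : ℂ)) := Complex.ofRealCLM.contDiff.comp hg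
  have hgs' : HasCompactSupport (fun x => (g x : ℂ)) :=
    hgs.comp_left (g := fun x : ℝ => (x : ℂ)) (by simp)
  set G : SchwartzMap ℝ ℂ := hgs'.toSchwartzMap hg' with hG
  have hGx : ∀ x, G x = (g x : ℂ) := fun x => rfl
  have h1 := congrArg (fun T => T G) (Lp.fourier_toTemperedDistribution_eq (hf2.toLp f))
  simp only [TemperedDistribution.fourier_apply, Lp.toTemperedDistribution_apply] at h1
  have h2 : ∫ x, (𝓕 G) x • (hf2.toLp f) x = ∫ x, (𝓕 G) x • f x := by
    refine integral_congr_ae ?_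
    filter_upwards [hf2.coeFn_toLp] with x hx
    rw [hx]
  have h3 : ∫ x, (𝓕 G) x • f x = ∫ x, G x • (𝓕 f) x := by
    have := VectorFourier.integral_fourierIntegral_smul_eq_flip (μ := volume) (ν := volume)
      (L := innerₗ ℝ) (e := Real.fourierChar) (f := G) (g := f)
      Real.continuous_fourierChar (by fun_prop) G.integrable hf
    rw [flip_innerₗ] at this
    exact this
  rw [h2, h3] at h1
  simpa [hGx] using h1.symm

/-- **Plancherel's theorem** on `L¹ ∩ L²`. -/
theorem integrable_norm_sq_fourier_and_integral_eq {f : ℝ → ℂ} (hf : Integrable f)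
    (hf2 : MemLp f 2) :
    Integrable (fun ξ => ‖𝓕 f ξ‖ ^ 2) ∧ ∫ ξ, ‖𝓕 f ξ‖ ^ 2 = ∫ x, ‖f x‖ ^ 2 := by
  have hae := coeFn_fourier_toLp_ae_eq hf hf2
  have hmem : MemLp (𝓕 f) 2 := (memLp_congr_ae hae).1 (Lp.memLp _)
  refine ⟨hmem.integrable_norm_pow (by norm_num), ?_⟩
  have key : ∀ {g : ℝ → ℂ} (hg : MemLp g 2), ‖hg.toLp g‖ ^ 2 = ∫ x, ‖g x‖ ^ 2 := by
    intro g hg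
    have h := inner_self_eq_norm_sq (𝕜 := ℂ) (hg.toLp g)
    rw [← h, L2.inner_def]
    have : ∫ x, inner ℂ ((hg.toLp g) x) ((hg.toLp g) x) = ((∫ x, ‖g x‖ ^ 2 : ℝ) : ℂ) := by
      rw [← integral_complex_ofReal]
      refine integral_congr_ae ?_
      filter_upwards [hg.coeFn_toLp] with x hx
      rw [hx, inner_self_eq_norm_sq_to_K]
      push_cast
      rfl
    rw [this]
    simp
  rw [← key hmem, ← key hf2]
  have : hmem.toLp (𝓕 f) = 𝓕 (hf2.toLp f) := by
    apply Lp.ext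
    exact hmem.coeFn_toLp.trans hae.symm
  rw [this, Lp.norm_fourier_eq]

/-- **Parseval's formula for the Mellin transform** on the line `Re s = σ`. -/
theorem integrable_norm_sq_mellin_and_integral_eq {f : ℝ → ℂ} {σ : ℝ}
    (hf : Integrable fun u : ℝ => Real.exp (-σ * u) • f (Real.exp (-u)))
    (hf2 : MemLp (fun u : ℝ => Real.exp (-σ * u) • f (Real.exp (-u))) 2) :
    Integrable (fun t : ℝ => ‖mellin f (σ + t * Complex.I)‖ ^ 2) ∧
      ∫ t : ℝ, ‖mellin f (σ + t * Complex.I)‖ ^ 2 =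
        2 * Real.pi * ∫ u : ℝ, ‖Real.exp (-σ * u) • f (Real.exp (-u))‖ ^ 2 := by
  obtain ⟨h1, h2⟩ := integrable_norm_sq_fourier_and_integral_eq hf hf2
  have hm : ∀ t : ℝ, mellin f (σ + t * Complex.I) =
      𝓕 (fun u : ℝ => Real.exp (-σ * u) • f (Real.exp (-u))) (t / (2 * Real.pi)) := by
    intro t
    rw [mellin_eq_fourier]
    simp
  simp_rw [hm]
  constructor
  · exact h1.comp_div (by positivity)
  · rw [Measure.integral_comp_div (fun ξ => ‖𝓕 (fun u : ℝ => Real.exp (-σ * u) •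
      f (Real.exp (-u))) ξ‖ ^ 2), h2, smul_eq_mul, abs_of_pos (by positivity)]

end Plancherel

/-- A function bounded by a multiple of `exp (-|u| / 2)` lies in `L¹ ∩ L²`. -/
theorem integrable_and_memLp_two_of_norm_le {g : ℝ → ℂ} (hg : AEStronglyMeasurable g) {C : ℝ}
    (hC : ∀ u, ‖g u‖ ≤ C * Real.exp (-(|u| / 2))) : Integrable g ∧ MemLp g 2 := by
  have he : Integrable fun u : ℝ => Real.exp (-(|u| / 2)) := by
    rw [← integrableOn_univ, ← Set.Iic_union_Ioi (a := (0 : ℝ))]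
    refine IntegrableOn.union ?_ ?_
    · refine (integrableOn_exp_mul_Iic (a := 1 / 2) (by norm_num) 0).congr_fun ?_ measurableSet_Iic
      intro x hx
      simp only [abs_of_nonpos (show x ≤ 0 from hx)]
      ring_nf
    · refine (integrableOn_exp_mul_Ioi (a := -(1 / 2)) (by norm_num) 0).congr_fun ?_
        measurableSet_Ioi
      intro x hx
      simp only [abs_of_pos (show 0 < x from hx)]
      ring_nf
  have hint : Integrable g := (he.const_mul C).mono' hg (Eventually.of_forall hC)
  refine ⟨hint, ?_⟩
  rw [memLp_two_iff_integrable_sq_norm hg]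
  refine (he.const_mul (C ^ 2)).mono' (hg.norm.pow 2) (Eventually.of_forall fun u => ?_)
  have h1 : Real.exp (-(|u| / 2)) ≤ 1 := Real.exp_le_one_iff.2 (by have := abs_nonneg u; linarith)
  rw [Real.norm_of_nonneg (by positivity)]
  calc ‖g u‖ ^ 2 ≤ (C * Real.exp (-(|u| / 2))) ^ 2 := by gcongr; exact hC u
    _ = C ^ 2 * (Real.exp (-(|u| / 2)) * Real.exp (-(|u| / 2))) := by ring
    _ ≤ C ^ 2 * (Real.exp (-(|u| / 2)) * 1) := by gcongr
    _ = _ := by ring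

/-! ### The Mellin transform of the fractional part -/

section ZetaMellin

open Complex

/-- Cutting `fract (1 / x)` off at `x = 1` removes the tail `1 / x`, which restricts convergence to
`Re s < 1`; the truncated transform is holomorphic on the whole half plane `0 < Re s`, so that the
formula for it can be continued from `1 < Re s`. -/
theorem mellinConvergent_indicator_fract_inv {s : ℂ} (hs : 0 < s.re) :
    MellinConvergent ((Set.Iio (1 : ℝ)).indicator fun x => ((Int.fract x⁻¹ : ℝ) : ℂ)) s ∧
    DifferentiableAt ℂ
      (mellin ((Set.Iio (1 : ℝ)).indicator fun x => ((Int.fract x⁻¹ : ℝ) : ℂ))) s := by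
  have hmeas : Measurable ((Set.Iio (1 : ℝ)).indicator fun x => ((Int.fract x⁻¹ : ℝ) : ℂ)) :=
    Measurable.indicator (by fun_prop) measurableSet_Iio
  have hb : ∀ x : ℝ, ‖(Set.Iio (1 : ℝ)).indicator (fun x => ((Int.fract x⁻¹ : ℝ) : ℂ)) x‖ ≤ 1 := by
    intro x
    refine (norm_indicator_le_norm_self _ _).trans ?_
    rw [norm_real, Real.norm_of_nonneg (Int.fract_nonneg _)]
    exact (Int.fract_lt_one _).le
  have hloc : LocallyIntegrableOn
      ((Set.Iio (1 : ℝ)).indicator fun x => ((Int.fract x⁻¹ : ℝ) : ℂ)) (Set.Ioi 0) := by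
    refine LocallyIntegrable.locallyIntegrableOn ?_ _
    refine (locallyIntegrable_const (1 : ℝ)).mono hmeas.aestronglyMeasurable ?_
    exact Eventually.of_forall fun x => (hb x).trans (by simp)
  have htop : ((Set.Iio (1 : ℝ)).indicator fun x => ((Int.fract x⁻¹ : ℝ) : ℂ)) =O[atTop]
      (fun x : ℝ => x ^ (-(s.re + 1))) := by
    refine Asymptotics.IsBigO.of_bound 1 ?_
    filter_upwards [eventually_ge_atTop 1] with x hx
    rw [Set.indicator_of_notMem (by simpa using hx)]
    simp
  have hbot : ((Set.Iio (1 : ℝ)).indicator fun x => ((Int.fract x⁻¹ : ℝ) : ℂ)) =O[𝓝[>] 0]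
      (fun x : ℝ => x ^ (-(0 : ℝ))) := by
    refine Asymptotics.IsBigO.of_bound 1 (Eventually.of_forall fun x => ?_)
    simpa using hb x
  exact ⟨mellinConvergent_of_isBigO_rpow hloc htop (by linarith) hbot hs,
    mellin_differentiableAt_of_isBigO_rpow hloc htop (by linarith) hbot hs⟩

/-- Substituting `x = 1 / t` gives `∫₁^∞ (t - ⌊t⌋) t^(-s-1) dt`, and the part with `⌊t⌋` is
`ζ(s) / s` by partial summation. -/
theorem mul_mellin_indicator_fract_inv_of_one_lt {s : ℂ} (hs : 1 < s.re) :
    s * mellin ((Set.Iio (1 : ℝ)).indicator fun x => ((Int.fract x⁻¹ : ℝ) : ℂ)) s =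
      s / (s - 1) - riemannZeta s := by
  have hs0 : s ≠ 0 := by rintro rfl; simp at hs; linarith
  have hs1 : s - 1 ≠ 0 := by
    intro h
    have := congrArg re h
    simp at this; linarith
  have hz : riemannZeta s = s * ∫ t in Set.Ioi (1 : ℝ), ((⌊t⌋₊ : ℕ) : ℂ) * t ^ (-(s + 1)) := by
    rw [← LSeries_one_eq_riemannZeta hs]
    have := LSeries_eq_mul_integral_of_nonneg (fun _ => 1) (r := 1) zero_le_one hs ?_
      (fun _ => zero_le_one)
    · simpa [Pi.one_def] using this
    · simpa using Asymptotics.isBigO_refl _ _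
  have hpow : ∀ t ∈ Set.Ioi (1 : ℝ), (t : ℂ) * (t : ℂ) ^ (-(s + 1)) = (t : ℂ) ^ (-s) := by
    intro t ht
    have ht0 : (t : ℂ) ≠ 0 := by
      rw [ofReal_ne_zero]; exact (zero_lt_one.trans ht).ne'
    rw [show -s = 1 + -(s + 1) by ring, cpow_add _ _ ht0, cpow_one]
  have hint1 : ∫ t in Set.Ioi (1 : ℝ), (t : ℂ) * (t : ℂ) ^ (-(s + 1)) = 1 / (s - 1) := by
    rw [setIntegral_congr_fun measurableSet_Ioi hpow,
      integral_Ioi_cpow_of_lt (by simpa using hs) one_pos]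
    rw [ofReal_one, one_cpow, show -s + 1 = -(s - 1) by ring, neg_div_neg_eq]
  have hI1 : IntegrableOn (fun t : ℝ => (t : ℂ) * (t : ℂ) ^ (-(s + 1))) (Set.Ioi 1) := by
    rw [integrableOn_congr_fun hpow measurableSet_Ioi]
    exact integrableOn_Ioi_cpow_of_lt (by simpa using hs) one_pos
  have hI2 : IntegrableOn (fun t : ℝ => ((⌊t⌋₊ : ℕ) : ℂ) * (t : ℂ) ^ (-(s + 1))) (Set.Ioi 1) := by
    refine Integrable.mono hI1 ?_ ?_
    · refine AEStronglyMeasurable.mul ?_ ?_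
      · exact ((measurable_from_nat (f := fun n : ℕ => (n : ℂ))).comp
          Nat.measurable_floor).aestronglyMeasurable
      · exact (by fun_prop : Measurable fun t : ℝ => (t : ℂ) ^ (-(s + 1))).aestronglyMeasurable
    · filter_upwards [ae_restrict_mem measurableSet_Ioi] with t ht
      have ht0 : (0 : ℝ) ≤ t := (zero_lt_one.trans ht).le
      rw [norm_mul, norm_mul]
      gcongr
      rw [Complex.norm_natCast, norm_real, Real.norm_of_nonneg ht0]
      exact Nat.floor_le ht0
  have hm : mellin ((Set.Iio (1 : ℝ)).indicator fun x => ((Int.fract x⁻¹ : ℝ) : ℂ)) s =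
      ∫ t in Set.Ioi (1 : ℝ), ((t : ℂ) * (t : ℂ) ^ (-(s + 1)) -
        ((⌊t⌋₊ : ℕ) : ℂ) * (t : ℂ) ^ (-(s + 1))) := by
    have h := mellin_comp_inv
      (fun t : ℝ => (Set.Iio (1 : ℝ)).indicator (fun x => ((Int.fract x⁻¹ : ℝ) : ℂ)) t⁻¹) s
    simp only [inv_inv] at h
    rw [h, mellin, ← integral_indicator measurableSet_Ioi, ← integral_indicator measurableSet_Ioi]
    congr 1
    ext t
    by_cases ht : 1 < t
    · have ht0 : 0 < t := zero_lt_one.trans ht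
      rw [Set.indicator_of_mem (show t ∈ Set.Ioi (0 : ℝ) from ht0),
        Set.indicator_of_mem (show t ∈ Set.Ioi (1 : ℝ) from ht),
        Set.indicator_of_mem (show t⁻¹ ∈ Set.Iio (1 : ℝ) from inv_lt_one_of_one_lt₀ ht), inv_inv,
        Int.fract, ← natCast_floor_eq_intCast_floor ht0.le, smul_eq_mul,
        show -s - 1 = -(s + 1) by ring]
      push_cast
      ring
    · rw [Set.indicator_of_notMem (show t ∉ Set.Ioi (1 : ℝ) from ht)]
      by_cases ht0 : 0 < t
      · rw [Set.indicator_of_mem (show t ∈ Set.Ioi (0 : ℝ) from ht0),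
          Set.indicator_of_notMem, smul_zero]
        simp only [Set.mem_Iio, not_lt]
        exact (one_le_inv₀ ht0).2 (not_lt.1 ht)
      · rw [Set.indicator_of_notMem (show t ∉ Set.Ioi (0 : ℝ) from ht0)]
  rw [hm, integral_sub hI1 hI2, hint1, hz]
  ring

theorem mul_mellin_indicator_fract_inv {s : ℂ} (hs : 0 < s.re) (hs1 : s ≠ 1) :
    s * mellin ((Set.Iio (1 : ℝ)).indicator fun x => ((Int.fract x⁻¹ : ℝ) : ℂ)) s =
      s / (s - 1) - riemannZeta s := by
  set G := mellin ((Set.Iio (1 : ℝ)).indicator fun x => ((Int.fract x⁻¹ : ℝ) : ℂ)) with hG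
  have hU : IsOpen {z : ℂ | 0 < z.re} := isOpen_lt continuous_const continuous_re
  -- the identity theorem, after clearing the pole at `1`: `riemannZeta₁` is `(z - 1) ζ(z)`
  have hA : AnalyticOnNhd ℂ (fun z => (z - 1) * (z * G z)) {z : ℂ | 0 < z.re} := by
    refine DifferentiableOn.analyticOnNhd (fun z hz => ?_) hU
    have := (mellinConvergent_indicator_fract_inv (s := z) hz).2
    exact (DifferentiableAt.mul (by fun_prop)
      (DifferentiableAt.mul (by fun_prop) this)).differentiableWithinAt
  have hB : AnalyticOnNhd ℂ (fun z => z - riemannZeta₁ z) {z : ℂ | 0 < z.re} := by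
    refine DifferentiableOn.analyticOnNhd ?_ hU
    exact (differentiable_id.sub differentiable_riemannZeta₁).differentiableOn
  have hsub : ∀ z : ℂ, z ≠ 1 → z - 1 ≠ 0 := fun z hz => sub_ne_zero.2 hz
  have hev : (fun z => (z - 1) * (z * G z)) =ᶠ[𝓝 (2 : ℂ)]
      (fun z => z - riemannZeta₁ z) := by
    have : {z : ℂ | 1 < z.re} ∈ 𝓝 (2 : ℂ) :=
      (isOpen_lt continuous_const continuous_re).mem_nhds (by simp)
    filter_upwards [this] with z hz
    have hz1 : z ≠ 1 := by rintro rfl; simp at hz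
    have := hsub z hz1
    rw [mul_mellin_indicator_fract_inv_of_one_lt hz,
      riemannZeta_eq_inv_sub_mul hz1]
    field_simp
  have hconv : Convex ℝ {z : ℂ | 0 < z.re} := convex_halfSpace_re_gt 0
  have := hA.eqOn_of_preconnected_of_eventuallyEq hB hconv.isPreconnected
    (show (2 : ℂ) ∈ {z : ℂ | 0 < z.re} by simp) hev (show s ∈ {z : ℂ | 0 < z.re} from hs)
  have h1 := hsub s hs1
  simp only at this
  rw [riemannZeta_eq_inv_sub_mul hs1]
  field_simp
  linear_combination this

/-- In the critical strip the Mellin transform of the fractional part of `1 / x` is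
`-ζ(s) / s`. -/
theorem mellin_fract_inv {s : ℂ} (hs : 0 < s.re) (hs1 : s.re < 1) :
    mellin (fun x : ℝ => ((Int.fract x⁻¹ : ℝ) : ℂ)) s = -riemannZeta s / s ∧
      MellinConvergent (fun x : ℝ => ((Int.fract x⁻¹ : ℝ) : ℂ)) s := by
  have hs0 : s ≠ 0 := by rintro rfl; simp at hs
  have hsne : s ≠ 1 := by rintro rfl; simp at hs1
  have hsub : s - 1 ≠ 0 := sub_ne_zero.2 hsne
  have h1 := (mellinConvergent_indicator_fract_inv hs).1
  have hpow : ∀ t ∈ Set.Ioi (1 : ℝ), (t : ℂ) ^ (s - 1) • (t : ℂ)⁻¹ = (t : ℂ) ^ (s - 2) := by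
    intro t ht
    have ht0 : (t : ℂ) ≠ 0 := by
      rw [ofReal_ne_zero]; exact (zero_lt_one.trans ht).ne'
    rw [smul_eq_mul, ← cpow_neg_one, ← cpow_add _ _ ht0]
    ring_nf
  have heq : ∀ t : ℝ, (t : ℂ) ^ (s - 1) • (Set.Ioi (1 : ℝ)).indicator (fun x : ℝ => (x : ℂ)⁻¹) t =
      (Set.Ioi (1 : ℝ)).indicator (fun t : ℝ => (t : ℂ) ^ (s - 2)) t := by
    intro t
    by_cases ht : t ∈ Set.Ioi (1 : ℝ)
    · rw [Set.indicator_of_mem ht, Set.indicator_of_mem ht, hpow t ht]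
    · rw [Set.indicator_of_notMem ht, Set.indicator_of_notMem ht, smul_zero]
  have hinter : Set.Ioi (0 : ℝ) ∩ Set.Ioi 1 = Set.Ioi 1 := by
    rw [Set.Ioi_inter_Ioi]; simp
  have h2 : MellinConvergent ((Set.Ioi (1 : ℝ)).indicator fun x : ℝ => (x : ℂ)⁻¹) s := by
    unfold MellinConvergent
    simp_rw [heq]
    rw [integrableOn_indicator_iff measurableSet_Ioi, Set.inter_comm, hinter]
    exact integrableOn_Ioi_cpow_of_lt (by simp; linarith) one_pos
  have h2' : mellin ((Set.Ioi (1 : ℝ)).indicator fun x : ℝ => (x : ℂ)⁻¹) s = -1 / (s - 1) := by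
    unfold mellin
    simp_rw [heq]
    rw [setIntegral_indicator measurableSet_Ioi, hinter,
      integral_Ioi_cpow_of_lt (by simp; linarith) one_pos]
    rw [ofReal_one, one_cpow]
    ring_nf
  have hae : (fun x : ℝ => ((Int.fract x⁻¹ : ℝ) : ℂ)) =ᵐ[volume.restrict (Set.Ioi 0)] fun x =>
      (Set.Iio (1 : ℝ)).indicator (fun x => ((Int.fract x⁻¹ : ℝ) : ℂ)) x +
      (Set.Ioi (1 : ℝ)).indicator (fun x : ℝ => (x : ℂ)⁻¹) x := by
    have hne : ∀ᵐ x : ℝ ∂(volume.restrict (Set.Ioi 0)), x ≠ 1 :=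
      ae_restrict_of_ae (by simp [ae_iff, measure_singleton])
    filter_upwards [hne] with x hx
    rcases lt_or_gt_of_ne hx with h | h
    · rw [Set.indicator_of_mem (show x ∈ Set.Iio (1 : ℝ) from h),
        Set.indicator_of_notMem (by simpa using h.le), add_zero]
    · rw [Set.indicator_of_notMem (by simpa using h.le),
        Set.indicator_of_mem (show x ∈ Set.Ioi (1 : ℝ) from h), zero_add,
        Int.fract_eq_self.2 ⟨by positivity, inv_lt_one_of_one_lt₀ h⟩]
      push_cast
      rfl
  have hadd := hasMellin_add h1 h2
  constructor
  · refine (integral_congr_ae (hae.mono fun x hx =>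
      congrArg (fun w => (x : ℂ) ^ (s - 1) • w) hx)).trans (hadd.2.trans ?_)
    rw [h2']
    have h3 := mul_mellin_indicator_fract_inv hs hsne
    have h4 : mellin ((Set.Iio (1 : ℝ)).indicator fun x => ((Int.fract x⁻¹ : ℝ) : ℂ)) s =
      (s / (s - 1) - riemannZeta s) / s := by rw [← h3]; field_simp
    rw [h4]
    field_simp
    ring
  · exact hadd.1.congr (hae.symm.mono fun x hx => congrArg (fun w => (x : ℂ) ^ (s - 1) • w) hx)

end ZetaMellin

/-! ### Parseval's formula for the increments of the fractional part -/

/-- The spectral density `|ζ(s) / s|²` on the critical line `s = 1/2 + it`. -/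
noncomputable def zetaDensity (t : ℝ) : ℝ :=
  ‖riemannZeta (1 / 2 + (t : ℂ) * Complex.I) / (1 / 2 + (t : ℂ) * Complex.I)‖ ^ 2

theorem zetaDensity_nonneg (t : ℝ) : 0 ≤ zetaDensity t := by
  unfold zetaDensity; positivity

/-- The integrand of the quadratic mean of the increments `fract ((1 + h) y) - fract y`. The weight
`1 / y²` is what the weight `x^(-1/2)` of the critical line becomes under `y = 1 / x`. -/
noncomputable def fractIncrSq (h y : ℝ) : ℝ :=
  (Int.fract ((1 + h) * y) - Int.fract y) ^ 2 / y ^ 2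

theorem fract_le_min {x : ℝ} (hx : 0 ≤ x) : Int.fract x ≤ min 1 x := by
  refine le_min (Int.fract_lt_one x).le ?_
  have : 0 ≤ ⌊x⌋ := Int.floor_nonneg.2 hx
  have h : (0 : ℝ) ≤ ⌊x⌋ := by exact_mod_cast this
  rw [Int.fract]; linarith

theorem exp_half_mul_min_le (u : ℝ) : Real.exp (-(1 / 2) * u) * min 1 (Real.exp u) ≤
    Real.exp (-(|u| / 2)) := by
  rcases le_total 0 u with h | h
  · rw [abs_of_nonneg h]
    calc _ ≤ Real.exp (-(1 / 2) * u) * 1 := by gcongr; exact min_le_left _ _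
      _ = _ := by rw [mul_one]; ring_nf
  · rw [abs_of_nonpos h]
    calc _ ≤ Real.exp (-(1 / 2) * u) * Real.exp u := by gcongr; exact min_le_right _ _
      _ = _ := by rw [← Real.exp_add]; ring_nf

theorem half_add_mul_I_eq (t : ℝ) : (((1 / 2 : ℝ) : ℂ) + t * Complex.I) =
    1 / 2 + (t : ℂ) * Complex.I := by push_cast; ring

/-- `|ζ(s) / s|²` is integrable on the critical line because it is the squared modulus of the
Mellin transform of `fract (1 / x)`. -/
theorem integrable_zetaDensity : Integrable zetaDensity := by
  have hb : ∀ u : ℝ, ‖Real.exp (-(1 / 2) * u) •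
      (((Int.fract (Real.exp (-u))⁻¹ : ℝ) : ℂ))‖ ≤ 1 * Real.exp (-(|u| / 2)) := by
    intro u
    rw [norm_smul, Real.norm_of_nonneg (Real.exp_pos _).le, Complex.norm_real,
      Real.norm_of_nonneg (Int.fract_nonneg _), one_mul, ← Real.exp_neg, neg_neg]
    refine le_trans ?_ (exp_half_mul_min_le u)
    gcongr
    exact fract_le_min (Real.exp_pos _).le
  have hg : Measurable fun u : ℝ => Real.exp (-(1 / 2) * u) •
      (((Int.fract (Real.exp (-u))⁻¹ : ℝ) : ℂ)) := by fun_prop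
  obtain ⟨h1, h2⟩ := integrable_and_memLp_two_of_norm_le hg.aestronglyMeasurable hb
  have := (integrable_norm_sq_mellin_and_integral_eq (σ := 1 / 2)
    (f := fun x : ℝ => ((Int.fract x⁻¹ : ℝ) : ℂ)) h1 h2).1
  refine this.congr (Eventually.of_forall fun t => ?_)
  simp only [half_add_mul_I_eq]
  rw [(mellin_fract_inv (by simp) (by simp; norm_num)).1, zetaDensity, neg_div, norm_neg]

/-- Taking the increment multiplies the transform `-ζ(s) / s` by `(1 + h)^s - 1`, whose squared
modulus on the critical line is the cosine kernel of `norm_sq_cpow_sub_one`. -/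
theorem mellin_fract_increment {h : ℝ} (hh : 0 < h) {s : ℂ} (hs : 0 < s.re) (hs1 : s.re < 1) :
    mellin (fun x : ℝ => ((Int.fract ((1 + h) * x⁻¹) - Int.fract x⁻¹ : ℝ) : ℂ)) s =
      (((1 + h : ℝ) : ℂ) ^ s - 1) * (-riemannZeta s / s) := by
  obtain ⟨h1, h2⟩ := mellin_fract_inv hs hs1
  have hpos : 0 < (1 + h)⁻¹ := by positivity
  have h3 : MellinConvergent (fun x : ℝ => ((Int.fract ((1 + h)⁻¹ * x)⁻¹ : ℝ) : ℂ)) s :=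
    (MellinConvergent.comp_mul_left (f := fun x : ℝ => ((Int.fract x⁻¹ : ℝ) : ℂ)) hpos).2 h2
  have h4 := mellin_comp_mul_left (fun x : ℝ => ((Int.fract x⁻¹ : ℝ) : ℂ)) s hpos
  have h5 := (hasMellin_sub h3 h2).2
  have h6 : (fun x : ℝ => ((Int.fract ((1 + h) * x⁻¹) - Int.fract x⁻¹ : ℝ) : ℂ)) =
      fun x : ℝ => ((Int.fract ((1 + h)⁻¹ * x)⁻¹ : ℝ) : ℂ) - ((Int.fract x⁻¹ : ℝ) : ℂ) := by
    ext x
    rw [mul_inv, inv_inv]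
    push_cast
    rfl
  rw [h6, h5, h4, h1, Complex.ofReal_inv, Complex.inv_cpow_eq_ite, if_neg, Complex.cpow_neg,
    inv_inv, smul_eq_mul]
  · ring
  · rw [Complex.arg_ofReal_of_nonneg (by positivity)]
    exact Real.pi_pos.ne

theorem norm_sq_cpow_sub_one {l : ℝ} (hl : 0 < l) (t : ℝ) :
    ‖(l : ℂ) ^ (1 / 2 + (t : ℂ) * Complex.I) - 1‖ ^ 2 =
      (1 + l) - 2 * √l * Real.cos (t * Real.log l) := by
  have h1 : (l : ℂ) ^ (1 / 2 + (t : ℂ) * Complex.I) =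
      (√l : ℝ) * Complex.exp ((t * Real.log l : ℝ) * Complex.I) := by
    rw [Complex.cpow_add _ _ (by exact_mod_cast hl.ne'), Real.sqrt_eq_rpow,
      Complex.ofReal_cpow hl.le]
    congr 1
    · push_cast; rfl
    · rw [Complex.cpow_def_of_ne_zero (by exact_mod_cast hl.ne'), ← Complex.ofReal_log hl.le]
      push_cast; ring_nf
  rw [h1, ← Complex.normSq_eq_norm_sq, Complex.exp_mul_I, ← Complex.ofReal_cos,
    ← Complex.ofReal_sin, Complex.normSq_apply]
  simp only [Complex.sub_re, Complex.mul_re, Complex.add_re, Complex.ofReal_re, Complex.ofReal_im,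
    Complex.I_re, Complex.I_im, Complex.sub_im, Complex.mul_im, Complex.add_im, Complex.one_re,
    Complex.one_im]
  have h2 : √l * √l = l := Real.mul_self_sqrt hl.le
  have h3 := Real.sin_sq_add_cos_sq (t * Real.log l)
  generalize √l = r at *
  generalize Real.sin (t * Real.log l) = x at *
  generalize Real.cos (t * Real.log l) = y at *
  linear_combination (r * r) * h3 + h2

/-- Parseval's formula for the increments of the fractional part. -/
theorem integral_fractIncrSq_eq {h : ℝ} (hh : 0 < h) :
    IntegrableOn (fractIncrSq h) (Set.Ioi 0) ∧
      2 * Real.pi * ∫ y in Set.Ioi (0 : ℝ), fractIncrSq h y =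
        ∫ t, zetaDensity t * ((2 + h) - 2 * √(1 + h) * Real.cos (t * Real.log (1 + h))) := by
  have hb : ∀ u : ℝ, ‖Real.exp (-(1 / 2) * u) •
      (((Int.fract ((1 + h) * (Real.exp (-u))⁻¹) - Int.fract (Real.exp (-u))⁻¹ : ℝ) : ℂ))‖ ≤
        (1 + h) * Real.exp (-(|u| / 2)) := by
    intro u
    rw [norm_smul, Real.norm_of_nonneg (Real.exp_pos _).le, Complex.norm_real, Real.norm_eq_abs,
      ← Real.exp_neg, neg_neg]
    calc _ ≤ Real.exp (-(1 / 2) * u) * ((1 + h) * min 1 (Real.exp u)) := by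
          gcongr
          have hu := Real.exp_pos u
          have h1 := fract_le_min (show 0 ≤ (1 + h) * Real.exp u by positivity)
          have h2 := fract_le_min hu.le
          have h3 : min 1 ((1 + h) * Real.exp u) ≤ (1 + h) * min 1 (Real.exp u) := by
            rw [mul_min_of_nonneg _ _ (by linarith : (0 : ℝ) ≤ 1 + h)]
            exact min_le_min_right _ (by linarith)
          have h4 : min 1 (Real.exp u) ≤ (1 + h) * min 1 (Real.exp u) :=
            le_mul_of_one_le_left (by positivity) (by linarith)
          exact abs_sub_le_of_nonneg_of_le (Int.fract_nonneg _) (h1.trans h3)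
            (Int.fract_nonneg _) (h2.trans h4)
      _ = (1 + h) * (Real.exp (-(1 / 2) * u) * min 1 (Real.exp u)) := by ring
      _ ≤ _ := by gcongr; exact exp_half_mul_min_le u
  have hg : Measurable fun u : ℝ => Real.exp (-(1 / 2) * u) •
      (((Int.fract ((1 + h) * (Real.exp (-u))⁻¹) - Int.fract (Real.exp (-u))⁻¹ : ℝ) : ℂ)) := by
    fun_prop
  obtain ⟨h1, h2⟩ := integrable_and_memLp_two_of_norm_le hg.aestronglyMeasurable hb
  have hm := (integrable_norm_sq_mellin_and_integral_eq (σ := 1 / 2)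
    (f := fun x : ℝ => ((Int.fract ((1 + h) * x⁻¹) - Int.fract x⁻¹ : ℝ) : ℂ)) h1 h2).2
  have hsq : ∀ u : ℝ, ‖Real.exp (-(1 / 2) * u) •
      (((Int.fract ((1 + h) * (Real.exp (-u))⁻¹) - Int.fract (Real.exp (-u))⁻¹ : ℝ) : ℂ))‖ ^ 2 =
        |Real.exp u| • fractIncrSq h (Real.exp u) := by
    intro u
    rw [norm_smul, mul_pow, Complex.norm_real, Real.norm_eq_abs, Real.norm_eq_abs, sq_abs, sq_abs,
      abs_of_pos (Real.exp_pos u), ← Real.exp_neg, neg_neg, fractIncrSq, smul_eq_mul]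
    have : Real.exp (-(1 / 2) * u) ^ 2 = (Real.exp u)⁻¹ := by
      rw [← Real.exp_nat_mul, ← Real.exp_neg]; push_cast; ring_nf
    rw [this]
    field_simp
  have himg : Real.exp '' Set.univ = Set.Ioi 0 := by rw [Set.image_univ, Real.range_exp]
  have hder : ∀ x ∈ (Set.univ : Set ℝ), HasDerivWithinAt Real.exp (Real.exp x) Set.univ x :=
    fun x _ => (Real.hasDerivAt_exp x).hasDerivWithinAt
  constructor
  · have := (memLp_two_iff_integrable_sq_norm hg.aestronglyMeasurable).1 h2
    simp only [hsq] at this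
    rw [← himg, integrableOn_image_iff_integrableOn_abs_deriv_smul MeasurableSet.univ hder
      Real.exp_injective.injOn, integrableOn_univ]
    exact this
  · rw [← himg, integral_image_eq_integral_abs_deriv_smul MeasurableSet.univ hder
      Real.exp_injective.injOn, setIntegral_univ]
    simp only [hsq] at hm
    rw [← hm]
    refine integral_congr_ae (Eventually.of_forall fun t => ?_)
    simp only [half_add_mul_I_eq]
    rw [mellin_fract_increment hh (by simp) (by simp; norm_num), norm_mul, mul_pow,
      norm_sq_cpow_sub_one (by positivity), zetaDensity, neg_div, norm_neg]
    ring

/-! ### The near range, and the constant from Stirling's formula -/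

theorem fractIncrSq_eq_of_floor {h y : ℝ} {a b : ℤ} (ha : ⌊(1 + h) * y⌋ = a) (hb : ⌊y⌋ = b) :
    fractIncrSq h y = (h * y - (a - b)) ^ 2 / y ^ 2 := by
  rw [fractIncrSq, Int.fract, Int.fract, ha, hb]
  ring_nf

/-- On `[n, n + 1]` the increment of `fract` jumps exactly once, at `(n + 1) / (1 + h)`. -/
theorem integral_fractIncrSq_unit {h : ℝ} (hh : 0 < h) (n : ℕ) (hn : (n + 1) * h ≤ 1) :
    ∫ y in (n : ℝ)..(n + 1), fractIncrSq h y =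
      h / (n + 1) + (h ^ 2 - 2 * h * Real.log (1 + h)) := by
  have hint := (integral_fractIncrSq_eq hh).1
  have hn0 : (0 : ℝ) ≤ n := n.cast_nonneg
  set c : ℝ := (n + 1) / (1 + h) with hc
  have hc0 : 0 < c := by positivity
  have hnc : (n : ℝ) ≤ c := by
    rw [hc, le_div_iff₀ (by positivity)]; nlinarith
  have hcn : c ≤ n + 1 := by
    rw [hc, div_le_iff₀ (by positivity)]; nlinarith
  have hI : ∀ a b : ℝ, 0 ≤ a → a ≤ b → IntervalIntegrable (fractIncrSq h) volume a b := by
    intro a b ha hab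
    rw [intervalIntegrable_iff_integrableOn_Ioc_of_le hab]
    exact hint.mono_set fun x hx => ha.trans_lt hx.1
  -- before `c` both floors are `n`; after `c` the floor of `(1 + h) y` is `n + 1`
  rw [← intervalIntegral.integral_add_adjacent_intervals (hI _ _ hn0 hnc) (hI _ _ hc0.le hcn)]
  have h1 : ∫ y in (n : ℝ)..c, fractIncrSq h y = ∫ y in (n : ℝ)..c, h ^ 2 := by
    refine intervalIntegral.integral_congr_Ioo_of_le hnc fun y hy => ?_
    have hy0 : 0 < y := hn0.trans_lt hy.1
    have hyc := hy.2
    rw [hc, lt_div_iff₀ (by positivity)] at hyc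
    rw [fractIncrSq_eq_of_floor (a := n) (b := n)]
    · field_simp
      ring
    · rw [Int.floor_eq_iff]
      constructor <;> push_cast <;> nlinarith [hy.1]
    · rw [Int.floor_eq_iff]
      constructor <;> push_cast <;> nlinarith [hy.1]
  have h2 : ∫ y in c..(n + 1 : ℝ), fractIncrSq h y =
      ∫ y in c..(n + 1 : ℝ), (h ^ 2 - 2 * h * (1 / y) + 1 / y ^ 2) := by
    refine intervalIntegral.integral_congr_Ioo_of_le hcn fun y hy => ?_
    have hy0 : 0 < y := hc0.trans hy.1
    have hyc := hy.1
    rw [hc, div_lt_iff₀ (by positivity)] at hyc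
    rw [fractIncrSq_eq_of_floor (a := n + 1) (b := n)]
    · push_cast
      field_simp
      ring
    · rw [Int.floor_eq_iff]
      constructor <;> push_cast <;> nlinarith [hy.2]
    · rw [Int.floor_eq_iff]
      constructor <;> push_cast <;> nlinarith [hy.2]
  have h3 : ∫ y in c..(n + 1 : ℝ), (h ^ 2 - 2 * h * (1 / y) + 1 / y ^ 2) =
      (h ^ 2 * (n + 1) - 2 * h * Real.log (n + 1) - 1 / (n + 1)) -
        (h ^ 2 * c - 2 * h * Real.log c - 1 / c) := by
    refine intervalIntegral.integral_eq_sub_of_hasDerivAt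
      (f := fun y => h ^ 2 * y - 2 * h * Real.log y - 1 / y) (fun y hy => ?_) ?_
    · rw [Set.uIcc_of_le hcn] at hy
      have hy0 : y ≠ 0 := (hc0.trans_le hy.1).ne'
      have := (((hasDerivAt_id y).const_mul (h ^ 2)).sub
        ((Real.hasDerivAt_log hy0).const_mul (2 * h))).sub (hasDerivAt_inv hy0)
      simp only [one_div]
      convert! this using 1
      simp
    · refine ContinuousOn.intervalIntegrable fun y hy => ?_
      rw [Set.uIcc_of_le hcn] at hy
      have hy0 : y ≠ 0 := (hc0.trans_le hy.1).ne'
      exact ContinuousAt.continuousWithinAt (by fun_prop (disch := positivity))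
  rw [h1, h2, h3, intervalIntegral.integral_const, hc, Real.log_div (by positivity) (by positivity),
    smul_eq_mul]
  field_simp
  ring

/-- The near range: up to `1 / h` the quadratic mean is a harmonic sum, which is how Euler's constant
enters. -/
theorem integral_fractIncrSq_zero_nat {h : ℝ} (hh : 0 < h) (M : ℕ) (hM : M * h ≤ 1) :
    ∫ y in (0 : ℝ)..M, fractIncrSq h y =
      h * harmonic M + M * (h ^ 2 - 2 * h * Real.log (1 + h)) := by
  have hint := (integral_fractIncrSq_eq hh).1
  induction M with
  | zero => simp
  | succ M ih =>
    push_cast at hM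
    have hI : ∀ a b : ℝ, 0 ≤ a → a ≤ b → IntervalIntegrable (fractIncrSq h) volume a b := by
      intro a b ha hab
      rw [intervalIntegrable_iff_integrableOn_Ioc_of_le hab]
      exact hint.mono_set fun x hx => ha.trans_lt hx.1
    rw [Nat.cast_succ, ← intervalIntegral.integral_add_adjacent_intervals
      (hI _ M le_rfl M.cast_nonneg) (hI M _ M.cast_nonneg (by linarith)), ih (by nlinarith),
      integral_fractIncrSq_unit hh M hM, harmonic_succ]
    push_cast
    ring

theorem fract_mul_one_sub_fract_mem (y : ℝ) :
    0 ≤ Int.fract y * (1 - Int.fract y) ∧ Int.fract y * (1 - Int.fract y) ≤ 1 := by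
  have h1 := Int.fract_nonneg y
  have h2 := (Int.fract_lt_one y).le
  constructor <;> nlinarith

theorem integrableOn_inv_sq_Ioi {a : ℝ} (ha : 0 < a) :
    IntegrableOn (fun y : ℝ => 1 / y ^ 2) (Set.Ioi a) := by
  refine (integrableOn_Ioi_rpow_of_lt (a := -2) (by norm_num) ha).congr_fun (fun y hy => ?_)
    measurableSet_Ioi
  have : 0 < y := ha.trans hy
  simp only
  rw [Real.rpow_neg this.le, one_div]
  norm_cast

theorem integrableOn_div_sq_of_bounded {a : ℝ} (ha : 0 < a) {k : ℝ → ℝ} (hk : Measurable k)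
    {C : ℝ} (hC : ∀ y, |k y| ≤ C) : IntegrableOn (fun y => k y / y ^ 2) (Set.Ioi a) := by
  refine ((integrableOn_inv_sq_Ioi ha).const_mul C).mono'
    (hk.div (measurable_id.pow_const 2)).aestronglyMeasurable
    (Eventually.of_forall fun y => ?_)
  rw [norm_div, Real.norm_eq_abs, Real.norm_of_nonneg (sq_nonneg y), mul_one_div]
  exact div_le_div_of_nonneg_right (hC y) (sq_nonneg y)

/-- The integral over `[n + 1, n + 2]` is a difference of two consecutive terms of the logarithm of
Stirling's sequence. -/
theorem integral_fract_mul_one_sub_unit (n : ℕ) :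
    ∫ y in ((n + 1 : ℕ) : ℝ)..((n + 2 : ℕ) : ℝ), Int.fract y * (1 - Int.fract y) / y ^ 2 =
      2 * (Real.log (Stirling.stirlingSeq (n + 1)) - Real.log (Stirling.stirlingSeq (n + 2))) := by
  have hle : ((n + 1 : ℕ) : ℝ) ≤ ((n + 2 : ℕ) : ℝ) := by push_cast; linarith
  have h1 : ∫ y in ((n + 1 : ℕ) : ℝ)..((n + 2 : ℕ) : ℝ), Int.fract y * (1 - Int.fract y) / y ^ 2 =
      ∫ y in ((n + 1 : ℕ) : ℝ)..((n + 2 : ℕ) : ℝ),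
        (-1 + (2 * n + 3) * (1 / y) - (n + 1) * (n + 2) * (1 / y ^ 2)) := by
    refine intervalIntegral.integral_congr_Ioo_of_le hle fun y hy => ?_
    push_cast at hy
    have hy0 : 0 < y := by have := hy.1; have : (0 : ℝ) ≤ n := n.cast_nonneg; linarith
    have hfl : ⌊y⌋ = ((n + 1 : ℕ) : ℤ) := by
      rw [Int.floor_eq_iff]
      constructor <;> push_cast <;> linarith [hy.1, hy.2]
    rw [Int.fract, hfl]
    push_cast
    field_simp
    ring
  have h3 : ∫ y in ((n + 1 : ℕ) : ℝ)..((n + 2 : ℕ) : ℝ),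
        (-1 + (2 * n + 3) * (1 / y) - (n + 1) * (n + 2) * (1 / y ^ 2)) =
      (-((n + 2 : ℕ) : ℝ) + (2 * n + 3) * Real.log ((n + 2 : ℕ) : ℝ) +
          (n + 1) * (n + 2) * (1 / ((n + 2 : ℕ) : ℝ))) -
        (-((n + 1 : ℕ) : ℝ) + (2 * n + 3) * Real.log ((n + 1 : ℕ) : ℝ) +
          (n + 1) * (n + 2) * (1 / ((n + 1 : ℕ) : ℝ))) := by
    refine intervalIntegral.integral_eq_sub_of_hasDerivAt
      (f := fun y => -y + (2 * n + 3) * Real.log y + (n + 1) * (n + 2) * (1 / y))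
      (fun y hy => ?_) ?_
    · rw [Set.uIcc_of_le hle] at hy
      have hy0 : y ≠ 0 := by
        have := hy.1; push_cast at this; have : (0 : ℝ) ≤ n := n.cast_nonneg
        exact ne_of_gt (by linarith)
      have := ((hasDerivAt_id y).neg.add
        ((Real.hasDerivAt_log hy0).const_mul (2 * (n : ℝ) + 3))).add
          ((hasDerivAt_inv hy0).const_mul (((n : ℝ) + 1) * (n + 2)))
      simp only [one_div]
      convert! this using 1
      ring
    · refine ContinuousOn.intervalIntegrable fun y hy => ?_
      rw [Set.uIcc_of_le hle] at hy
      have hy0 : y ≠ 0 := by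
        have := hy.1; push_cast at this; have : (0 : ℝ) ≤ n := n.cast_nonneg
        exact ne_of_gt (by linarith)
      exact ContinuousAt.continuousWithinAt (by fun_prop (disch := positivity))
  rw [h1, h3, Stirling.log_stirlingSeq_formula, Stirling.log_stirlingSeq_formula,
    Nat.factorial_succ (n + 1)]
  push_cast
  have e1 : (n : ℝ) + 1 ≠ 0 := by positivity
  have e2 : (n : ℝ) + 2 ≠ 0 := by positivity
  have e3 : ((n + 1).factorial : ℝ) ≠ 0 := by positivity
  rw [show (n : ℝ) + 1 + 1 = n + 2 by ring, Real.log_mul e2 (by exact_mod_cast e3),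
    Real.log_mul two_ne_zero e1, Real.log_mul two_ne_zero e2, Real.log_div e1 (Real.exp_ne_zero _),
    Real.log_div e2 (Real.exp_ne_zero _), Real.log_exp]
  field_simp
  ring

/-- The integrals over unit intervals telescope, and Stirling's formula gives the limit. This is
where `log (2π)` enters. -/
theorem integral_fract_mul_one_sub_fract :
    ∫ y in Set.Ioi (1 : ℝ), Int.fract y * (1 - Int.fract y) / y ^ 2 =
      2 - Real.log (2 * Real.pi) := by
  have hI : IntegrableOn (fun y : ℝ => Int.fract y * (1 - Int.fract y) / y ^ 2) (Set.Ioi 1) :=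
    integrableOn_div_sq_of_bounded one_pos (k := fun y => Int.fract y * (1 - Int.fract y))
      (by fun_prop) (C := 1) fun y => by
        have := fract_mul_one_sub_fract_mem y
        rw [abs_of_nonneg this.1]; exact this.2
  have hlim := intervalIntegral_tendsto_integral_Ioi 1 hI
    (tendsto_natCast_atTop_atTop.comp (tendsto_add_atTop_nat 1))
  have hpart : ∀ N : ℕ, ∫ y in (1 : ℝ)..((fun n : ℕ => (n : ℝ)) ∘ fun a => a + 1) N,
      Int.fract y * (1 - Int.fract y) / y ^ 2 =
      2 * (Real.log (Stirling.stirlingSeq 1) - Real.log (Stirling.stirlingSeq (N + 1))) := by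
    intro N
    induction N with
    | zero => simp
    | succ N ih =>
      have hII : ∀ a b : ℝ, 1 ≤ a → a ≤ b → IntervalIntegrable
          (fun y : ℝ => Int.fract y * (1 - Int.fract y) / y ^ 2) volume a b := by
        intro a b ha hab
        rw [intervalIntegrable_iff_integrableOn_Ioc_of_le hab]
        exact hI.mono_set fun x hx => ha.trans_lt hx.1
      simp only [Function.comp_apply] at ih ⊢
      rw [← intervalIntegral.integral_add_adjacent_intervals
        (hII 1 ((N + 1 : ℕ) : ℝ) le_rfl (by push_cast; linarith [(N.cast_nonneg : (0 : ℝ) ≤ N)]))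
        (hII _ _ (by push_cast; linarith [(N.cast_nonneg : (0 : ℝ) ≤ N)])
          (by push_cast; linarith)), ih, integral_fract_mul_one_sub_unit]
      ring
  simp_rw [hpart] at hlim
  have hst : Tendsto (fun N : ℕ => Real.log (Stirling.stirlingSeq (N + 1))) atTop
      (𝓝 (Real.log (√Real.pi))) :=
    ((Real.continuousAt_log (by positivity)).tendsto.comp
      (Stirling.tendsto_stirlingSeq_sqrt_pi.comp (tendsto_add_atTop_nat 1)))
  rw [tendsto_nhds_unique hlim ((tendsto_const_nhds.sub hst).const_mul 2), Stirling.stirlingSeq_one,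
    Real.log_div (Real.exp_ne_zero _) (by positivity), Real.log_exp,
    Real.log_sqrt (by norm_num), Real.log_sqrt Real.pi_pos.le,
    Real.log_mul two_ne_zero Real.pi_ne_zero]
  ring

/-! ### The far range -/

theorem abs_fract_sq_sub_fract_le (x : ℝ) : |Int.fract x ^ 2 - Int.fract x| ≤ 1 / 4 := by
  rw [abs_le]
  have h1 := Int.fract_nonneg x
  have h2 := (Int.fract_lt_one x).le
  constructor <;> nlinarith [sq_nonneg (Int.fract x - 1 / 2)]

theorem intervalIntegrable_sawtooth (β a b : ℝ) :
    IntervalIntegrable (fun y : ℝ => Int.fract (β * y) - 1 / 2) volume a b := by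
  refine (intervalIntegrable_const (c := (1 : ℝ))).mono_fun
    (by fun_prop : Measurable fun y : ℝ => Int.fract (β * y) - 1 / 2).aestronglyMeasurable
    (Eventually.of_forall fun x => ?_)
  have h1 := Int.fract_nonneg (β * x)
  have h2 := (Int.fract_lt_one (β * x)).le
  simp only [norm_one, Real.norm_eq_abs]
  rw [abs_le]
  constructor <;> linarith

/-- Integration by parts against the sawtooth `fract - 1/2`, whose antiderivative
`(fract² - fract) / 2` is continuous and bounded by `1/8`. -/
theorem abs_integral_mul_sawtooth_le {a b β K L : ℝ} (hab : a ≤ b) (hβ : 1 ≤ β) {g g' : ℝ → ℝ}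
    (hg : ∀ x ∈ Set.Icc a b, HasDerivAt g (g' x) x) (hg' : ContinuousOn g' (Set.Icc a b))
    (hK : ∀ x ∈ Set.Icc a b, |g x| ≤ K) (hL : ∀ x ∈ Set.Icc a b, |g' x| ≤ L) :
    |∫ y in a..b, g y * (Int.fract (β * y) - 1 / 2)| ≤ (2 * K + L * (b - a)) / 8 := by
  have hβ0 : 0 < β := by linarith
  set B : ℝ → ℝ := fun y => (Int.fract (β * y) ^ 2 - Int.fract (β * y)) / (2 * β) with hB
  have hBc : Continuous B := by
    have : Continuous fun y : ℝ => (fun _ t : ℝ => t ^ 2 - t) y (Int.fract (β * y)) :=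
      ContinuousOn.comp_fract (f := fun _ t : ℝ => t ^ 2 - t) (s := fun y => β * y)
        (by fun_prop) (by fun_prop) (by simp)
    exact this.div_const _
  have hBb : ∀ y, |B y| ≤ 1 / 8 := by
    intro y
    have := abs_fract_sq_sub_fract_le (β * y)
    rw [hB]
    simp only [abs_div]
    rw [abs_of_pos (by positivity : 0 < 2 * β), div_le_iff₀ (by positivity)]
    nlinarith
  have hBd : ∀ x, HasDerivWithinAt B (Int.fract (β * x) - 1 / 2) (Set.Ioi x) x := by
    intro x
    set m : ℤ := ⌊β * x⌋ with hm
    have h1 : HasDerivAt (fun y => ((β * y - m) ^ 2 - (β * y - m)) / (2 * β))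
        (Int.fract (β * x) - 1 / 2) x := by
      have h := ((((hasDerivAt_id x).const_mul β).sub_const (m : ℝ)).pow 2 |>.sub
        (((hasDerivAt_id x).const_mul β).sub_const (m : ℝ))).div_const (2 * β)
      convert! h using 1
      simp only [Int.fract, ← hm, id]
      field_simp
      ring
    refine h1.hasDerivWithinAt.congr_of_eventuallyEq ?_ ?_
    · have hlt : β * x < m + 1 := Int.lt_floor_add_one _
      have hcont : ContinuousWithinAt (fun y => β * y) (Set.Ioi x) x := by fun_prop
      filter_upwards [hcont.eventually_lt_const hlt, self_mem_nhdsWithin] with y hy hxy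
      have : ⌊β * y⌋ = m := by
        rw [Int.floor_eq_iff]
        refine ⟨(Int.floor_le (β * x)).trans ?_, hy⟩
        have : x < y := hxy
        gcongr
      simp only [hB, Int.fract, this]
    · simp only [hB, Int.fract, ← hm]
  have hcg : ContinuousOn g (Set.uIcc a b) := by
    rw [Set.uIcc_of_le hab]
    exact fun x hx => (hg x hx).continuousAt.continuousWithinAt
  have hparts := intervalIntegral.integral_mul_deriv_eq_deriv_mul_of_hasDeriv_right
    (u := g) (v := B) (u' := g') (v' := fun y => Int.fract (β * y) - 1 / 2) (a := a) (b := b)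
    hcg hBc.continuousOn
    (fun x hx => by
      rw [min_eq_left hab, max_eq_right hab] at hx
      exact (hg x ⟨hx.1.le, hx.2.le⟩).hasDerivWithinAt) (fun x _ => hBd x)
    (ContinuousOn.intervalIntegrable (by rwa [Set.uIcc_of_le hab]))
    (intervalIntegrable_sawtooth β a b)
  rw [hparts]
  have hint : |∫ x in a..b, g' x * B x| ≤ L / 8 * |b - a| := by
    rw [← Real.norm_eq_abs]
    refine intervalIntegral.norm_integral_le_of_norm_le_const fun x hx => ?_
    rw [Set.uIoc_of_le hab] at hx
    have h1 := hL x ⟨hx.1.le, hx.2⟩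
    rw [norm_mul, Real.norm_eq_abs, Real.norm_eq_abs, div_eq_mul_one_div]
    exact mul_le_mul h1 (hBb x) (abs_nonneg _) ((abs_nonneg _).trans h1)
  rw [abs_of_nonneg (sub_nonneg.2 hab)] at hint
  have h1 : |g b * B b| ≤ K * (1 / 8) := by
    rw [abs_mul]
    exact mul_le_mul (hK b ⟨hab, le_rfl⟩) (hBb b) (abs_nonneg _)
      ((abs_nonneg _).trans (hK b ⟨hab, le_rfl⟩))
  have h2 : |g a * B a| ≤ K * (1 / 8) := by
    rw [abs_mul]
    exact mul_le_mul (hK a ⟨le_rfl, hab⟩) (hBb a) (abs_nonneg _)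
      ((abs_nonneg _).trans (hK a ⟨le_rfl, hab⟩))
  rw [abs_le] at *
  constructor <;> linarith [hint.1, hint.2, h1.1, h1.2, h2.1, h2.2]

/-- The product by which the squared increment of `fract` deviates from the local average
`q (1 - q)`, `q = fract (h y)`. -/
noncomputable def fractCross (h y : ℝ) : ℝ :=
  (1 - 2 * Int.fract (h * y)) * (Int.fract y - Int.fract ((1 + h) * y))

/-- With `p = fract y` and `q = fract (h y)` the increment of `fract` is `q` or `q - 1`, according to
whether `p + q < 1`; in both cases its square is `q (1 - q)` plus the cross term. -/
theorem fractIncrSq_eq (h y : ℝ) :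
    fractIncrSq h y = Int.fract (h * y) * (1 - Int.fract (h * y)) / y ^ 2 +
      fractCross h y / y ^ 2 := by
  obtain ⟨z, hz⟩ := Int.fract_add y (h * y)
  have h1 : (1 + h) * y = y + h * y := by ring
  have hlo := Int.fract_nonneg (y + h * y)
  have hhi := Int.fract_lt_one (y + h * y)
  have h2 := Int.fract_nonneg y
  have h3 := Int.fract_lt_one y
  have h4 := Int.fract_nonneg (h * y)
  have h5 := Int.fract_lt_one (h * y)
  have hz1 : (-2 : ℝ) < z := by linarith
  have hz2 : (z : ℝ) < 1 := by linarith
  have hz3 : z = -1 ∨ z = 0 := by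
    have : (-2 : ℤ) < z := by exact_mod_cast hz1
    have : z < (1 : ℤ) := by exact_mod_cast hz2
    lia
  rw [fractIncrSq, fractCross, h1, ← add_div]
  congr 1
  rcases hz3 with rfl | rfl
  · push_cast at hz
    have : Int.fract (y + h * y) = Int.fract y + Int.fract (h * y) - 1 := by linarith
    rw [this]; ring
  · push_cast at hz
    have : Int.fract (y + h * y) = Int.fract y + Int.fract (h * y) := by linarith
    rw [this]; ring

theorem abs_fractCross_le (h y : ℝ) : |fractCross h y| ≤ 1 := by
  have h2 := Int.fract_nonneg y
  have h3 := (Int.fract_lt_one y).le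
  have h4 := Int.fract_nonneg (h * y)
  have h5 := (Int.fract_lt_one (h * y)).le
  have h6 := Int.fract_nonneg ((1 + h) * y)
  have h7 := (Int.fract_lt_one ((1 + h) * y)).le
  rw [fractCross, abs_mul]
  exact mul_le_one₀ (abs_le.2 ⟨by linarith, by linarith⟩) (abs_nonneg _)
    (abs_le.2 ⟨by linarith, by linarith⟩)

theorem measurable_fractCross (h : ℝ) : Measurable (fractCross h) := by
  unfold fractCross; fun_prop

/-- On `[(k + 1) / h, (k + 2) / h]` the factor `1 - 2 fract (h y)` is linear, and the other factor is
a difference of two sawtooth functions, so partial integration gains a factor `h`. -/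
theorem abs_integral_fractCross_piece_le {h : ℝ} (hh : 0 < h) (k : ℕ) :
    |∫ y in (((k + 1 : ℕ) : ℝ) / h)..(((k + 2 : ℕ) : ℝ) / h), fractCross h y / y ^ 2| ≤
      3 / 2 * h ^ 2 / (k + 1) ^ 2 := by
  set a : ℝ := ((k + 1 : ℕ) : ℝ) / h with ha
  set b : ℝ := ((k + 2 : ℕ) : ℝ) / h with hb
  have ha0 : 0 < a := by positivity
  have hab : a ≤ b := by rw [ha, hb]; gcongr; lia
  have hba : b - a = 1 / h := by rw [ha, hb]; push_cast; field_simp; ring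
  set g : ℝ → ℝ := fun y => (1 - 2 * (h * y - (k + 1))) * (y ^ 2)⁻¹ with hg
  set g' : ℝ → ℝ := fun y => -2 * h * (y ^ 2)⁻¹ +
    (1 - 2 * (h * y - (k + 1))) * (-(2 * y) / (y ^ 2) ^ 2) with hg'
  have hmem : ∀ y ∈ Set.Icc a b, 0 < y ∧ |1 - 2 * (h * y - (k + 1))| ≤ 1 ∧
      (y ^ 2)⁻¹ ≤ h ^ 2 / (k + 1) ^ 2 ∧ y⁻¹ ≤ h := by
    intro y hy
    have hy0 : 0 < y := ha0.trans_le hy.1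
    have h1 := hy.1
    have h2 := hy.2
    rw [ha, div_le_iff₀ hh] at h1
    rw [hb, le_div_iff₀ hh] at h2
    push_cast at h1 h2
    have hk : (0 : ℝ) ≤ k := k.cast_nonneg
    have h3 : y⁻¹ ≤ h / (k + 1) := by
      rw [inv_le_comm₀ hy0 (by positivity), inv_div, div_le_iff₀ hh]; exact h1
    refine ⟨hy0, abs_le.2 ⟨by nlinarith, by nlinarith⟩, ?_, h3.trans ?_⟩
    · rw [← inv_pow, ← div_pow]; gcongr
    · exact div_le_self hh.le (by linarith)
  have hderiv : ∀ y ∈ Set.Icc a b, HasDerivAt g (g' y) y := by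
    intro y hy
    have hy0 := (hmem y hy).1
    have e1 : HasDerivAt (fun y : ℝ => 1 - 2 * (h * y - (k + 1))) (-2 * h) y := by
      have := ((((hasDerivAt_id y).const_mul h).sub_const ((k : ℝ) + 1)).const_mul 2).const_sub 1
      convert! this using 1
      simp
    have e2 : HasDerivAt (fun y : ℝ => (y ^ 2)⁻¹) (-(2 * y) / (y ^ 2) ^ 2) y := by
      have := (hasDerivAt_pow 2 y).inv (by positivity)
      convert! this using 1
      simp
    exact e1.mul e2
  have hcont : ContinuousOn g' (Set.Icc a b) := by
    intro y hy
    have hy0 := (hmem y hy).1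
    exact ContinuousAt.continuousWithinAt (by rw [hg']; fun_prop (disch := positivity))
  have hK : ∀ y ∈ Set.Icc a b, |g y| ≤ h ^ 2 / (k + 1) ^ 2 := by
    intro y hy
    obtain ⟨hy0, h1, h2, -⟩ := hmem y hy
    rw [hg]
    simp only [abs_mul]
    rw [abs_of_pos (by positivity : 0 < (y ^ 2)⁻¹)]
    exact (mul_le_of_le_one_left (by positivity) h1).trans h2
  have hL : ∀ y ∈ Set.Icc a b, |g' y| ≤ 4 * h * (h ^ 2 / (k + 1) ^ 2) := by
    intro y hy
    obtain ⟨hy0, h1, h2, h3⟩ := hmem y hy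
    have h4 : -(2 * y) / (y ^ 2) ^ 2 = -(2 * y⁻¹ * (y ^ 2)⁻¹) := by field_simp
    have hp : (0 : ℝ) < (y ^ 2)⁻¹ := by positivity
    rw [hg']
    simp only
    rw [h4]
    refine (abs_add_le _ _).trans ?_
    have h5 : |-2 * h| = 2 * h := by rw [abs_mul, abs_of_pos hh]; norm_num
    rw [abs_mul, h5, abs_mul, abs_neg,
      abs_of_pos (by positivity : (0 : ℝ) < 2 * y⁻¹ * (y ^ 2)⁻¹), abs_of_pos hp]
    have h6 : |1 - 2 * (h * y - (k + 1))| * (2 * y⁻¹ * (y ^ 2)⁻¹) ≤ 2 * h * (y ^ 2)⁻¹ := by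
      refine (mul_le_of_le_one_left (by positivity) h1).trans ?_
      gcongr
    nlinarith [mul_le_mul_of_nonneg_left h2 hh.le]
  have hβ : (1 : ℝ) ≤ 1 + h := by linarith
  have i1 := abs_integral_mul_sawtooth_le hab le_rfl hderiv hcont hK hL
  have i2 := abs_integral_mul_sawtooth_le hab hβ hderiv hcont hK hL
  have hgI : ∀ β : ℝ, IntervalIntegrable (fun y => g y * (Int.fract (β * y) - 1 / 2))
      volume a b := by
    intro β
    have hgc : ContinuousOn g (Set.uIcc a b) := by
      rw [Set.uIcc_of_le hab]
      exact fun x hx => (hderiv x hx).continuousAt.continuousWithinAt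
    exact (intervalIntegrable_sawtooth β a b).continuousOn_mul hgc
  have heq : ∫ y in a..b, fractCross h y / y ^ 2 =
      (∫ y in a..b, g y * (Int.fract (1 * y) - 1 / 2)) -
        ∫ y in a..b, g y * (Int.fract ((1 + h) * y) - 1 / 2) := by
    rw [← intervalIntegral.integral_sub (hgI 1) (hgI _)]
    refine intervalIntegral.integral_congr_Ioo_of_le hab fun y hy => ?_
    have h1 := hy.1
    have h2 := hy.2
    rw [ha, div_lt_iff₀ hh] at h1
    rw [hb, lt_div_iff₀ hh] at h2
    push_cast at h1 h2
    have hfl : ⌊h * y⌋ = ((k + 1 : ℕ) : ℤ) := by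
      rw [Int.floor_eq_iff]
      constructor <;> push_cast <;> nlinarith
    have hfr : Int.fract (h * y) = h * y - (k + 1) := by rw [Int.fract, hfl]; push_cast; rfl
    rw [fractCross, hfr, hg, one_mul]
    ring
  rw [heq]
  refine (abs_sub _ _).trans ((add_le_add i1 i2).trans (le_of_eq ?_))
  rw [hba]
  field_simp
  ring

/-- In the far range `y > 1 / h` the cross term contributes only `O(h²)`. -/
theorem abs_integral_fractCross_le {h : ℝ} (hh : 0 < h) :
    |∫ y in Set.Ioi (1 / h), fractCross h y / y ^ 2| ≤ 3 * h ^ 2 := by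
  have h1h : 0 < 1 / h := by positivity
  have hI : IntegrableOn (fun y => fractCross h y / y ^ 2) (Set.Ioi (1 / h)) :=
    integrableOn_div_sq_of_bounded h1h (measurable_fractCross h) (abs_fractCross_le h)
  have hlim := intervalIntegral_tendsto_integral_Ioi (1 / h) hI
    ((tendsto_natCast_atTop_atTop.comp (tendsto_add_atTop_nat 1)).atTop_div_const hh)
  have hbound : ∀ N : ℕ, |∫ y in (1 / h)..(((N + 1 : ℕ) : ℝ) / h), fractCross h y / y ^ 2| ≤
      3 * h ^ 2 * (1 - 1 / (N + 1)) := by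
    intro N
    induction N with
    | zero => simp
    | succ N ih =>
      have hII : ∀ a b : ℝ, 1 / h ≤ a → a ≤ b → IntervalIntegrable
          (fun y : ℝ => fractCross h y / y ^ 2) volume a b := by
        intro a b ha hab
        rw [intervalIntegrable_iff_integrableOn_Ioc_of_le hab]
        exact hI.mono_set fun x hx => ha.trans_lt hx.1
      have e1 : 1 / h ≤ ((N + 1 : ℕ) : ℝ) / h := by
        gcongr; push_cast; linarith [(N.cast_nonneg : (0 : ℝ) ≤ N)]
      have e2 : ((N + 1 : ℕ) : ℝ) / h ≤ ((N + 1 + 1 : ℕ) : ℝ) / h := by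
        gcongr; lia
      rw [← intervalIntegral.integral_add_adjacent_intervals (hII _ _ le_rfl e1) (hII _ _ e1 e2)]
      refine (abs_add_le _ _).trans
        ((add_le_add ih (abs_integral_fractCross_piece_le hh N)).trans ?_)
      have hN : (0 : ℝ) ≤ N := N.cast_nonneg
      -- `1 / (N + 1)² ≤ 2 / ((N + 1) (N + 2))`, which telescopes
      have e3 : 3 / 2 * h ^ 2 / ((N : ℝ) + 1) ^ 2 ≤
          3 * h ^ 2 * (1 / (N + 1) - 1 / (N + 2)) := by
        have : 1 / ((N : ℝ) + 1) - 1 / (N + 2) = 1 / ((N + 1) * (N + 2)) := by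
          field_simp; ring
        rw [this, mul_one_div, div_le_div_iff₀ (by positivity) (by positivity)]
        have : 0 ≤ h ^ 2 * (N * (N + 1)) := by positivity
        nlinarith
      push_cast
      rw [show (N : ℝ) + 1 + 1 = N + 2 by ring]
      linarith
  refine le_of_tendsto hlim.abs (Eventually.of_forall fun N => (hbound N).trans ?_)
  have : (0 : ℝ) ≤ 1 / ((N : ℝ) + 1) := by positivity
  nlinarith [sq_nonneg h]

/-! ### The cosine transform of the spectral density near the origin -/

/-- The constant `κ` in `∫₀^∞ (fract ((1 + h) y) - fract y)² dy / y² = h (-log h + κ) + O(h²)`. It is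
`(γ - 1) + (2 - log (2π))`, the near range plus the far range. -/
noncomputable def incrConst : ℝ :=
  Real.eulerMascheroniConstant + 1 - Real.log (2 * Real.pi)

theorem integral_fract_mul_tail {h : ℝ} (hh : 0 < h) :
    ∫ y in Set.Ioi (1 / h), Int.fract (h * y) * (1 - Int.fract (h * y)) / y ^ 2 =
      h * (2 - Real.log (2 * Real.pi)) := by
  have h1 := integral_comp_mul_left_Ioi
    (fun y : ℝ => Int.fract y * (1 - Int.fract y) / y ^ 2) (1 / h) hh
  rw [mul_one_div_cancel hh.ne', integral_fract_mul_one_sub_fract, smul_eq_mul] at h1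
  have h2 : ∀ y : ℝ, Int.fract (h * y) * (1 - Int.fract (h * y)) / y ^ 2 =
      h ^ 2 * (Int.fract (h * y) * (1 - Int.fract (h * y)) / (h * y) ^ 2) := by
    intro y
    rw [mul_pow]
    field_simp
  simp_rw [h2]
  rw [integral_const_mul, h1]
  field_simp

theorem abs_harmonic_sub_log_sub_le {M : ℕ} (hM : 0 < M) :
    |(harmonic M : ℝ) - Real.log M - Real.eulerMascheroniConstant| ≤ 1 / M := by
  have hM' : (0 : ℝ) < M := by exact_mod_cast hM
  have h1 := (Real.eulerMascheroniSeq_lt_eulerMascheroniConstant M).le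
  have h2 := (Real.eulerMascheroniConstant_lt_eulerMascheroniSeq' M).le
  rw [Real.eulerMascheroniSeq] at h1
  rw [Real.eulerMascheroniSeq', if_neg hM.ne'] at h2
  have h3 : Real.log (M + 1) - Real.log M ≤ 1 / M := by
    rw [← Real.log_div (by positivity) hM'.ne']
    refine (Real.log_le_sub_one_of_pos (by positivity)).trans (le_of_eq ?_)
    field_simp
    ring
  rw [abs_le]
  constructor <;> linarith [show (0 : ℝ) < 1 / M by positivity]

/-- The quadratic mean of the increments `fract ((1 + h) y) - fract y`, up to `O(h²)`. -/
theorem abs_integral_fractIncrSq_sub_le {h : ℝ} (hh : 0 < h) (hh1 : h ≤ 1) :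
    |(∫ y in Set.Ioi (0 : ℝ), fractIncrSq h y) - h * (-Real.log h + incrConst)| ≤ 15 * h ^ 2 := by
  have hint := (integral_fractIncrSq_eq hh).1
  set M : ℕ := ⌊1 / h⌋₊ with hMdef
  have h1h : 1 ≤ 1 / h := by rwa [le_div_iff₀ hh, one_mul]
  have hMpos : 0 < M := Nat.floor_pos.2 h1h
  have hM1 : (1 : ℝ) ≤ M := by exact_mod_cast hMpos
  have hMle : (M : ℝ) ≤ 1 / h := Nat.floor_le (by positivity)
  have hMlt : 1 / h < M + 1 := Nat.lt_floor_add_one _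
  have hMh : M * h ≤ 1 := by rwa [le_div_iff₀ hh] at hMle
  have hMh' : 1 < (M + 1) * h := by rwa [div_lt_iff₀ hh] at hMlt
  have hMinv : 1 / (M : ℝ) ≤ 2 * h := by
    rw [div_le_iff₀ (by linarith)]; nlinarith
  have hI : ∀ a b : ℝ, 0 ≤ a → a ≤ b → IntervalIntegrable (fractIncrSq h) volume a b := by
    intro a b ha hab
    rw [intervalIntegrable_iff_integrableOn_Ioc_of_le hab]
    exact hint.mono_set fun x hx => ha.trans_lt hx.1
  -- `[0, M]` is evaluated exactly, `[M, 1 / h]` is negligible, `[1 / h, ∞)` is the far range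
  have hsplit : ∫ y in Set.Ioi (0 : ℝ), fractIncrSq h y =
      (∫ y in (0 : ℝ)..M, fractIncrSq h y) + (∫ y in (M : ℝ)..(1 / h), fractIncrSq h y) +
        ∫ y in Set.Ioi (1 / h), fractIncrSq h y := by
    rw [intervalIntegral.integral_add_adjacent_intervals (hI _ _ le_rfl M.cast_nonneg)
      (hI _ _ M.cast_nonneg hMle), intervalIntegral.integral_interval_add_Ioi hint
      (hint.mono_set (Set.Ioi_subset_Ioi (by positivity)))]
  have htail : ∫ y in Set.Ioi (1 / h), fractIncrSq h y = h * (2 - Real.log (2 * Real.pi)) +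
      ∫ y in Set.Ioi (1 / h), fractCross h y / y ^ 2 := by
    rw [← integral_fract_mul_tail hh, ← integral_add]
    · exact integral_congr_ae (Eventually.of_forall fun y => fractIncrSq_eq h y)
    · exact integrableOn_div_sq_of_bounded (by positivity)
        (k := fun y => Int.fract (h * y) * (1 - Int.fract (h * y))) (by fun_prop) (C := 1)
        fun y => by
          have := fract_mul_one_sub_fract_mem (h * y)
          rw [abs_of_nonneg this.1]; exact this.2
    · exact integrableOn_div_sq_of_bounded (by positivity) (measurable_fractCross h)
        (abs_fractCross_le h)
  have hmid : |∫ y in (M : ℝ)..(1 / h), fractIncrSq h y| ≤ 4 * h ^ 2 := by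
    rw [← Real.norm_eq_abs]
    have : ∀ y ∈ Set.uIoc (M : ℝ) (1 / h), ‖fractIncrSq h y‖ ≤ (2 * h) ^ 2 := by
      intro y hy
      rw [Set.uIoc_of_le hMle] at hy
      have hy0 : 0 < y := by linarith [hy.1]
      rw [fractIncrSq, norm_div, norm_pow, norm_pow, ← div_pow]
      refine pow_le_pow_left₀ (by positivity) ?_ 2
      rw [Real.norm_of_nonneg hy0.le, div_le_iff₀ hy0, Real.norm_eq_abs]
      have e1 : |Int.fract ((1 + h) * y) - Int.fract y| ≤ 1 :=
        abs_sub_le_of_nonneg_of_le (Int.fract_nonneg _) (Int.fract_lt_one _).le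
          (Int.fract_nonneg _) (Int.fract_lt_one _).le
      rw [div_le_iff₀ (by linarith)] at hMinv
      nlinarith [hy.1]
    refine (intervalIntegral.norm_integral_le_of_norm_le_const this).trans ?_
    rw [abs_of_nonneg (by linarith)]
    nlinarith [sq_nonneg h]
  have hcross := abs_integral_fractCross_le hh
  have hharm := abs_harmonic_sub_log_sub_le hMpos
  have hlogM : |Real.log M + Real.log h| ≤ 2 * h := by
    rw [← Real.log_mul (by linarith) hh.ne']
    have e1 : Real.log (M * h) ≤ 0 := Real.log_nonpos (by positivity) hMh
    have e2 := Real.one_sub_inv_le_log_of_pos (show 0 < M * h by positivity)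
    have e3 : (M * h)⁻¹ - 1 ≤ 1 / M := by
      rw [mul_inv, ← one_div, ← one_div]
      have : 1 / (M : ℝ) * (1 / h) ≤ 1 / M * (M + 1) := by gcongr
      have e4 : 1 / (M : ℝ) * (M + 1) = 1 + 1 / M := by field_simp
      linarith
    rw [abs_le]; constructor <;> linarith
  have hlog1 : |h - Real.log (1 + h)| ≤ h ^ 2 := by
    have e1 := Real.log_le_sub_one_of_pos (show 0 < 1 + h by linarith)
    have e2 := Real.one_sub_inv_le_log_of_pos (show 0 < 1 + h by linarith)
    have e3 : 1 - (1 + h)⁻¹ = h - h ^ 2 / (1 + h) := by field_simp; ring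
    have e4 : h ^ 2 / (1 + h) ≤ h ^ 2 := div_le_self (sq_nonneg h) (by linarith)
    rw [abs_le]; constructor <;> linarith
  rw [hsplit, htail, integral_fractIncrSq_zero_nat hh M hMh, incrConst]
  have hkey : h * (harmonic M : ℝ) + M * (h ^ 2 - 2 * h * Real.log (1 + h)) +
      (∫ y in (M : ℝ)..(1 / h), fractIncrSq h y) + (h * (2 - Real.log (2 * Real.pi)) +
        ∫ y in Set.Ioi (1 / h), fractCross h y / y ^ 2) -
      h * (-Real.log h + (Real.eulerMascheroniConstant + 1 - Real.log (2 * Real.pi))) =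
      h * ((harmonic M : ℝ) - Real.log M - Real.eulerMascheroniConstant) +
      h * (Real.log M + Real.log h) + h * (1 - M * h) +
      2 * (M * h) * (h - Real.log (1 + h)) +
      (∫ y in (M : ℝ)..(1 / h), fractIncrSq h y) +
      ∫ y in Set.Ioi (1 / h), fractCross h y / y ^ 2 := by ring
  rw [hkey]
  have b1 : |h * ((harmonic M : ℝ) - Real.log M - Real.eulerMascheroniConstant)| ≤ 2 * h ^ 2 := by
    rw [abs_mul, abs_of_pos hh]
    nlinarith
  have b2 : |h * (Real.log M + Real.log h)| ≤ 2 * h ^ 2 := by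
    rw [abs_mul, abs_of_pos hh]
    nlinarith
  have b3 : |h * (1 - M * h)| ≤ h ^ 2 := by
    rw [abs_mul, abs_of_pos hh, abs_of_nonneg (by linarith)]
    nlinarith
  have b4 : |2 * (M * h) * (h - Real.log (1 + h))| ≤ 2 * h ^ 2 := by
    rw [abs_mul, abs_of_nonneg (by positivity)]
    have : 0 ≤ M * h := by positivity
    nlinarith [abs_nonneg (h - Real.log (1 + h))]
  rw [abs_le] at *
  constructor <;> linarith [b1.1, b1.2, b2.1, b2.2, b3.1, b3.2, b4.1, b4.2, hmid.1, hmid.2,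
    hcross.1, hcross.2]

/-- The cosine transform `∫ |ζ(s) / s|² (1 - cos (t u)) dt`. -/
noncomputable def zetaCosTransform (u : ℝ) : ℝ := ∫ t, zetaDensity t * (1 - Real.cos (t * u))

theorem integrable_zetaDensity_mul {k : ℝ → ℝ} (hk : AEStronglyMeasurable k) {C : ℝ}
    (hC : ∀ t, |k t| ≤ C) : Integrable fun t => zetaDensity t * k t :=
  integrable_zetaDensity.mul_bdd hk (Eventually.of_forall hC)

theorem abs_zetaCosTransform_le (u : ℝ) :
    |zetaCosTransform u| ≤ 2 * ∫ t, zetaDensity t := by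
  rw [zetaCosTransform, ← Real.norm_eq_abs, ← integral_const_mul]
  refine norm_integral_le_of_norm_le (integrable_zetaDensity.const_mul 2)
    (Eventually.of_forall fun t => ?_)
  rw [norm_mul, Real.norm_of_nonneg (zetaDensity_nonneg t), mul_comm, Real.norm_eq_abs]
  refine mul_le_mul_of_nonneg_right ?_ (zetaDensity_nonneg t)
  rw [abs_le]
  constructor <;> linarith [Real.neg_one_le_cos (t * u), Real.cos_le_one (t * u)]

/-- Parseval's formula at `h = exp u - 1`. -/
theorem integral_fractIncrSq_eq_zetaCosTransform {u : ℝ} (hu : 0 < u) :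
    2 * Real.pi * ∫ y in Set.Ioi (0 : ℝ), fractIncrSq (Real.exp u - 1) y =
      (Real.exp (u / 2) - 1) ^ 2 * (∫ t, zetaDensity t) +
        2 * Real.exp (u / 2) * zetaCosTransform u := by
  have hh : 0 < Real.exp u - 1 := by linarith [Real.add_one_lt_exp hu.ne']
  have hsq : Real.exp u = Real.exp (u / 2) ^ 2 := by
    rw [← Real.exp_nat_mul]; push_cast; ring_nf
  rw [(integral_fractIncrSq_eq hh).2, zetaCosTransform, ← integral_const_mul, ← integral_const_mul,
    ← integral_add (integrable_zetaDensity.const_mul _)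
      ((integrable_zetaDensity_mul (k := fun t => 1 - Real.cos (t * u)) (by fun_prop) (C := 2)
        fun t => by
          rw [abs_le]
          constructor <;> linarith [Real.neg_one_le_cos (t * u), Real.cos_le_one (t * u)]).const_mul
        _)]
  refine integral_congr_ae (Eventually.of_forall fun t => ?_)
  simp only
  rw [show 1 + (Real.exp u - 1) = Real.exp u by ring, Real.log_exp]
  have : √(Real.exp u) = Real.exp (u / 2) := by
    rw [hsq, Real.sqrt_sq (Real.exp_pos _).le]
  rw [this, show 2 + (Real.exp u - 1) = 1 + Real.exp u by ring, hsq]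
  ring

/-- The asymptotic expansion at `u = 0` of the cosine transform, in a form that holds for all
`u > 0`: for `u > 1/2` both terms on the left are themselves `O(u²)`. -/
theorem exists_abs_zetaCosTransform_sub_le : ∃ C : ℝ, 0 ≤ C ∧ ∀ u : ℝ, 0 < u →
    |zetaCosTransform u - Real.pi * (u * (-Real.log u + incrConst))| ≤ C * u ^ 2 := by
  set m : ℝ := ∫ t, zetaDensity t with hm
  have hm0 : 0 ≤ m := integral_nonneg zetaDensity_nonneg
  set k : ℝ := |incrConst| with hk
  have hk0 : 0 ≤ k := abs_nonneg _
  have hpi := Real.pi_pos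
  refine ⟨Real.pi * (70 + 4 * k) + 8 * m, by positivity, fun u hu => ?_⟩
  rcases le_or_gt u (1 / 2) with hu2 | hu2
  · set r : ℝ := Real.exp (u / 2) with hr
    set h : ℝ := Real.exp u - 1 with hhdef
    have hr1 : 1 ≤ r := Real.one_le_exp (by linarith)
    have hb1 := Real.exp_bound' (x := u) hu.le (by linarith) (n := 3) (by norm_num)
    have hb2 := Real.exp_bound' (x := u / 2) (by linarith) (by linarith) (n := 2) (by norm_num)
    have hq1 := Real.quadratic_le_exp_of_nonneg hu.le
    have hq2 := Real.quadratic_le_exp_of_nonneg (show 0 ≤ u / 2 by linarith)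
    simp only [Finset.sum_range_succ, Finset.sum_range_zero, Nat.factorial] at hb1 hb2
    norm_num at hb1 hb2
    have hu3 : 0 < u ^ 3 := by positivity
    have hrle : r - 1 ≤ u := by
      have : (u / 2) ^ 2 ≤ u / 4 := by nlinarith
      linarith
    have hhle : h ≤ 2 * u := by
      have e1 : u ^ 2 ≤ u / 2 := by nlinarith
      have e2 : u ^ 3 ≤ u / 4 := by nlinarith
      linarith
    have hhu : u ≤ h := by nlinarith
    have hh : 0 < h := by linarith
    have hh1 : h ≤ 1 := by linarith
    -- `exp u - 1` and `u exp (u / 2)` agree up to `O(u³)`, so that no term of size `u² log u` arises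
    have hhru : |h - r * u| ≤ u ^ 3 := by
      have e1 : r * u ≤ u * (1 + u / 2 + (u / 2) ^ 2 * 3 / 4) := by
        rw [mul_comm]; gcongr
      have e2 : u * (1 + u / 2 + (u / 2) ^ 2 / 2) ≤ r * u := by
        rw [mul_comm r]; gcongr
      rw [abs_le]
      constructor <;> nlinarith
    have hD := abs_integral_fractIncrSq_sub_le hh hh1
    have hP := integral_fractIncrSq_eq_zetaCosTransform hu
    rw [← hr, ← hhdef, ← hm] at hP
    set D : ℝ := ∫ y in Set.Ioi (0 : ℝ), fractIncrSq h y with hDdef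
    have hlogu : |-Real.log u + incrConst| ≤ u⁻¹ + k := by
      refine (abs_add_le _ _).trans ?_
      rw [abs_neg, abs_of_nonpos (Real.log_nonpos hu.le (by linarith))]
      have := Real.one_sub_inv_le_log_of_pos hu
      gcongr
      linarith
    have hlogh : |Real.log u - Real.log h| ≤ u := by
      rw [abs_sub_comm, ← Real.log_div hh.ne' hu.ne',
        abs_of_nonneg (Real.log_nonneg (by rw [le_div_iff₀ hu]; linarith))]
      refine (Real.log_le_sub_one_of_pos (by positivity)).trans ?_
      rw [sub_le_iff_le_add, div_le_iff₀ hu]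
      have e1 : u ^ 3 ≤ u ^ 2 / 2 := by nlinarith [sq_nonneg u]
      nlinarith
    have hmain : |D - r * (u * (-Real.log u + incrConst))| ≤ (63 + k) * u ^ 2 := by
      have e0 : D - r * (u * (-Real.log u + incrConst)) =
          (D - h * (-Real.log h + incrConst)) + (h - r * u) * (-Real.log u + incrConst) +
            h * (Real.log u - Real.log h) := by ring
      have e1 : |(h - r * u) * (-Real.log u + incrConst)| ≤ (1 + k) * u ^ 2 := by
        rw [abs_mul]
        refine (mul_le_mul hhru hlogu (abs_nonneg _) hu3.le).trans ?_
        have : u ^ 3 * (u⁻¹ + k) = u ^ 2 + k * u ^ 2 * u := by field_simp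
        rw [this]
        have : k * u ^ 2 * u ≤ k * u ^ 2 := mul_le_of_le_one_right (by positivity) (by linarith)
        linarith
      have e2 : |h * (Real.log u - Real.log h)| ≤ 2 * u ^ 2 := by
        rw [abs_mul, abs_of_pos hh]
        refine (mul_le_mul hhle hlogh (abs_nonneg _) (by linarith)).trans (le_of_eq (by ring))
      have e3 : 15 * h ^ 2 ≤ 60 * u ^ 2 := by nlinarith
      rw [e0]
      refine (abs_add_three _ _ _).trans ?_
      linarith
    have hfin : zetaCosTransform u - Real.pi * (u * (-Real.log u + incrConst)) =
        (Real.pi * (D - r * (u * (-Real.log u + incrConst))) - (r - 1) ^ 2 * m / 2) / r := by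
      field_simp
      linarith
    rw [hfin, abs_div, abs_of_pos (by linarith : 0 < r)]
    refine (div_le_self (abs_nonneg _) hr1).trans ((abs_sub _ _).trans ?_)
    rw [abs_mul, abs_of_pos hpi, abs_of_nonneg (by positivity : 0 ≤ (r - 1) ^ 2 * m / 2)]
    have e4 : (r - 1) ^ 2 ≤ u ^ 2 := by gcongr
    have e5 : (r - 1) ^ 2 * m ≤ u ^ 2 * m := by gcongr
    have e6 := mul_le_mul_of_nonneg_left hmain hpi.le
    have e7 : 0 ≤ Real.pi * k * u ^ 2 := by positivity
    have e8 : 0 ≤ Real.pi * u ^ 2 := by positivity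
    have e9 : 0 ≤ u ^ 2 * m := by positivity
    linarith
  · have h1 := abs_zetaCosTransform_le u
    have h2 : |Real.log u| ≤ u + 2 := by
      have e1 := Real.log_le_sub_one_of_pos hu
      have e2 := Real.one_sub_inv_le_log_of_pos hu
      have e3 : u⁻¹ ≤ 2 := by rw [inv_le_comm₀ hu (by norm_num)]; linarith
      rw [abs_le]; constructor <;> linarith
    have h3 : |Real.pi * (u * (-Real.log u + incrConst))| ≤ Real.pi * (u * (u + 2 + k)) := by
      rw [abs_mul, abs_mul, abs_of_pos hpi, abs_of_pos hu]
      gcongr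
      refine (abs_add_le _ _).trans ?_
      rw [abs_neg]
      gcongr
    refine (abs_sub _ _).trans ((add_le_add h1 h3).trans ?_)
    rw [← hm]
    have e1 : u ≤ 2 * u ^ 2 := by nlinarith
    have e2 : 1 ≤ 4 * u ^ 2 := by nlinarith
    have e3 : 2 * m ≤ 8 * m * u ^ 2 := by nlinarith
    have e4 : u * (u + 2 + k) ≤ (70 + 4 * k) * u ^ 2 := by nlinarith
    have e5 := mul_le_mul_of_nonneg_left e4 hpi.le
    linarith

/-! ### Laplace transforms and Poisson means -/

theorem zetaDensity_neg (t : ℝ) : zetaDensity (-t) = zetaDensity t := by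
  have h : (1 / 2 + ((-t : ℝ) : ℂ) * Complex.I) =
      (starRingEnd ℂ) (1 / 2 + (t : ℂ) * Complex.I) := by
    apply Complex.ext <;> simp
  rw [zetaDensity, zetaDensity, h, riemannZeta_conj, ← map_div₀, Complex.norm_conj]

theorem integrableOn_pow_mul_exp_neg {H : ℝ} (hH : 0 < H) (n : ℕ) :
    IntegrableOn (fun u : ℝ => u ^ n * Real.exp (-H * u)) (Set.Ioi 0) ∧
    ∫ u in Set.Ioi (0 : ℝ), u ^ n * Real.exp (-H * u) = n.factorial / H ^ (n + 1) := by
  have hfun : ∀ u ∈ Set.Ioi (0 : ℝ), u ^ (((n : ℝ) + 1) - 1) * Real.exp (-(H * u)) =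
      u ^ n * Real.exp (-H * u) := by
    intro u _
    rw [add_sub_cancel_right, Real.rpow_natCast, neg_mul]
  have h2 := Real.integral_rpow_mul_exp_neg_mul_Ioi (a := (n : ℝ) + 1) (r := H) (by positivity) hH
  have hsq : (1 / H) ^ ((n : ℝ) + 1) = 1 / H ^ (n + 1) := by
    rw [← Nat.cast_succ, Real.rpow_natCast, one_div_pow]
  rw [setIntegral_congr_fun measurableSet_Ioi hfun, Real.Gamma_nat_eq_factorial, hsq] at h2
  have h3 : ∫ u in Set.Ioi (0 : ℝ), u ^ n * Real.exp (-H * u) = n.factorial / H ^ (n + 1) := by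
    rw [h2]; ring
  refine ⟨?_, h3⟩
  -- a nonzero value of the integral forces integrability
  by_contra hcon
  rw [integral_undef hcon] at h3
  have : 0 < (n.factorial : ℝ) / H ^ (n + 1) := by positivity
  linarith

/-- `Γ'(2) = 1 - γ` as a Laplace transform. -/
theorem integral_mul_log_mul_exp_neg {r : ℝ} (hr : 0 < r) :
    IntegrableOn (fun u : ℝ => (u : ℂ) * Real.log u * Complex.exp (-r * u)) (Set.Ioi 0) ∧
    ∫ u in Set.Ioi (0 : ℝ), (u : ℂ) * Real.log u * Complex.exp (-r * u) =
      (1 - Real.eulerMascheroniConstant - Complex.log r) / r ^ 2 := by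
  obtain ⟨s, hsr⟩ : ∃ s : ℂ, s = (r : ℂ) := ⟨_, rfl⟩
  rw [← hsr]
  have hre : s.re = r := by simp [hsr]
  have hs : 0 < s.re := by rwa [hre]
  have hs0 : s ≠ 0 := by rintro rfl; simp at hs
  set f : ℝ → ℂ := fun u => Complex.exp (-s * u) with hf
  have hnorm : ∀ u : ℝ, ‖f u‖ = Real.exp (-s.re * u) := by
    intro u
    rw [hf, Complex.norm_exp]
    simp
  have hfc : Continuous f := by fun_prop
  have htop : f =O[atTop] (fun x : ℝ => x ^ (-(3 : ℝ))) := by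
    refine Asymptotics.IsBigO.trans ?_ (isLittleO_exp_neg_mul_rpow_atTop hs (-(3 : ℝ))).isBigO
    refine Asymptotics.IsBigO.of_bound 1 (Eventually.of_forall fun u => ?_)
    rw [hnorm, Real.norm_of_nonneg (Real.exp_pos _).le, one_mul]
  have hbot : f =O[𝓝[>] 0] (fun x : ℝ => x ^ (-(0 : ℝ))) := by
    refine Asymptotics.IsBigO.of_bound 1 ?_
    filter_upwards [self_mem_nhdsWithin] with u hu
    have hu' : (0 : ℝ) < u := hu
    rw [hnorm]
    simp only [neg_zero, Real.rpow_zero, norm_one, mul_one]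
    exact Real.exp_le_one_iff.2 (by nlinarith)
  obtain ⟨hconv, hder⟩ := mellin_hasDerivAt_of_isBigO_rpow (s := 2)
    (hfc.locallyIntegrable.locallyIntegrableOn _) htop (by norm_num) hbot (by norm_num)
  have hmel : mellin f =ᶠ[𝓝 (2 : ℂ)] fun z => (1 / s) ^ z * Complex.Gamma z := by
    have : {z : ℂ | 0 < z.re} ∈ 𝓝 (2 : ℂ) :=
      (isOpen_lt continuous_const Complex.continuous_re).mem_nhds (by simp)
    filter_upwards [this] with z hz
    rw [hsr, ← Complex.integral_cpow_mul_exp_neg_mul_Ioi hz hr]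
    simp only [mellin, hf, smul_eq_mul, neg_mul, hsr]
  have hG : HasDerivAt Complex.Gamma (1 - Real.eulerMascheroniConstant) 2 := by
    have := Complex.hasDerivAt_Gamma_nat 1
    convert! this using 1
    · simp; ring
    · norm_num
  have hpow : HasDerivAt (fun z : ℂ => (1 / s) ^ z) ((1 / s) ^ (2 : ℂ) * Complex.log (1 / s)) 2 := by
    have := (hasDerivAt_id (2 : ℂ)).const_cpow (c := 1 / s) (Or.inl (by simpa using hs0))
    simpa using this
  have hd2 := ((hpow.mul hG).congr_of_eventuallyEq hmel).unique hder
  have hG2 : Complex.Gamma 2 = 1 := by simp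
  have hlog : Complex.log (1 / s) = -Complex.log s := by
    rw [one_div, Complex.log_inv]
    intro h
    have := Complex.arg_eq_pi_iff.1 h
    linarith [this.1]
  have hsq : (1 / s) ^ (2 : ℂ) = 1 / s ^ 2 := by
    rw [show (2 : ℂ) = ((2 : ℕ) : ℂ) by norm_num, Complex.cpow_natCast, one_div_pow]
  have hfun : ∀ u ∈ Set.Ioi (0 : ℝ), (u : ℂ) ^ ((2 : ℂ) - 1) • (Real.log u • f u) =
      (u : ℂ) * Real.log u * Complex.exp (-s * u) := by
    intro u _
    rw [show (2 : ℂ) - 1 = 1 by norm_num, Complex.cpow_one, hf, smul_eq_mul, Complex.real_smul]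
    ring
  constructor
  · exact IntegrableOn.congr_fun hconv hfun measurableSet_Ioi
  · rw [← setIntegral_congr_fun measurableSet_Ioi hfun]
    change mellin (fun t => Real.log t • f t) 2 = _
    rw [← hd2, hG2, hlog, hsq]
    ring

theorem measurable_mul_neg_log_add (k : ℝ) : Measurable fun u : ℝ => u * (-Real.log u + k) := by
  fun_prop

theorem abs_mul_neg_log_add_le (k : ℝ) {u : ℝ} (hu : 0 < u) :
    |u * (-Real.log u + k)| ≤ (1 + |k|) * (1 + u ^ 2) := by
  have h1 := Real.log_le_sub_one_of_pos hu
  have h2 := Real.one_sub_inv_le_log_of_pos hu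
  have h3 : |u * Real.log u| ≤ 1 + u ^ 2 := by
    have h4 : u * u⁻¹ = 1 := mul_inv_cancel₀ hu.ne'
    rw [abs_le]
    constructor <;> nlinarith
  have h5 : |u * k| ≤ |k| * (1 + u ^ 2) := by
    rw [abs_mul, abs_of_pos hu, mul_comm]
    gcongr
    nlinarith [sq_nonneg (u - 1)]
  have h6 : u * (-Real.log u + k) = u * k - u * Real.log u := by ring
  rw [h6]
  refine (abs_sub _ _).trans ?_
  linarith

/-- The Laplace transform of `u (-log u + k)` in the right half plane, by analytic continuation
from the positive reals. -/
theorem integral_mul_neg_log_add_mul_exp_neg (k : ℝ) {s : ℂ} (hs : 0 < s.re) :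
    IntegrableOn (fun u : ℝ => ((u * (-Real.log u + k) : ℝ) : ℂ) * Complex.exp (-s * u))
      (Set.Ioi 0) ∧
    ∫ u in Set.Ioi (0 : ℝ), ((u * (-Real.log u + k) : ℝ) : ℂ) * Complex.exp (-s * u) =
      (Complex.log s + Real.eulerMascheroniConstant - 1 + k) / s ^ 2 := by
  set F : ℂ → ℝ → ℂ := fun z u => ((u * (-Real.log u + k) : ℝ) : ℂ) * Complex.exp (-z * u) with hF
  have hnorm : ∀ (z : ℂ) (u : ℝ), ‖Complex.exp (-z * u)‖ = Real.exp (-z.re * u) := by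
    intro z u
    rw [Complex.norm_exp]
    simp
  have hmeas : ∀ z, AEStronglyMeasurable (F z) (volume.restrict (Set.Ioi 0)) := by
    intro z
    exact ((Complex.measurable_ofReal.comp (measurable_mul_neg_log_add k)).mul
      (by fun_prop)).aestronglyMeasurable
  have hFI : ∀ z : ℂ, 0 < z.re → IntegrableOn (F z) (Set.Ioi 0) := by
    intro z hz
    refine Integrable.mono' (g := fun u => (1 + |k|) * (u ^ 0 * Real.exp (-z.re * u) +
      u ^ 2 * Real.exp (-z.re * u))) ?_ (hmeas z) ?_
    · exact ((integrableOn_pow_mul_exp_neg hz 0).1.add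
        (integrableOn_pow_mul_exp_neg hz 2).1).const_mul _
    · filter_upwards [ae_restrict_mem measurableSet_Ioi] with u hu
      rw [hF, norm_mul, hnorm, Complex.norm_real, Real.norm_eq_abs]
      refine (mul_le_mul_of_nonneg_right (abs_mul_neg_log_add_le k hu)
        (Real.exp_pos _).le).trans (le_of_eq (by ring))
  have hdiff : DifferentiableOn ℂ (fun z => ∫ u in Set.Ioi (0 : ℝ), F z u) {z | 0 < z.re} := by
    intro z hz
    have hz' : 0 < z.re := hz
    have hball : ∀ w ∈ Metric.ball z (z.re / 2), z.re / 2 ≤ w.re := by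
      intro w hw
      have h1 := (Complex.abs_re_le_norm (w - z)).trans (mem_ball_iff_norm.1 hw).le
      rw [Complex.sub_re, abs_le] at h1
      linarith [h1.1]
    have := (hasDerivAt_integral_of_dominated_loc_of_deriv_le (F := F)
      (F' := fun w u => -(u : ℂ) * F w u) (x₀ := z) (s := Metric.ball z (z.re / 2))
      (μ := volume.restrict (Set.Ioi 0))
      (bound := fun u => (1 + |k|) * (u ^ 1 * Real.exp (-(z.re / 2) * u) +
        u ^ 3 * Real.exp (-(z.re / 2) * u)))
      (Metric.ball_mem_nhds z (by linarith)) (Eventually.of_forall hmeas) (hFI z hz')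
      ((by fun_prop : Measurable fun u : ℝ => -(u : ℂ)).aestronglyMeasurable.mul (hmeas z))
      ?_ ?_ ?_).2
    · exact this.differentiableAt.differentiableWithinAt
    · filter_upwards [ae_restrict_mem measurableSet_Ioi] with u hu w hw
      have hu' : (0 : ℝ) < u := hu
      rw [hF, norm_mul, norm_mul, hnorm, Complex.norm_real, Real.norm_eq_abs, norm_neg,
        Complex.norm_real, Real.norm_of_nonneg hu'.le]
      have h1 : Real.exp (-w.re * u) ≤ Real.exp (-(z.re / 2) * u) := by
        gcongr
        exact hball w hw
      calc u * (|u * (-Real.log u + k)| * Real.exp (-w.re * u))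
          ≤ u * (((1 + |k|) * (1 + u ^ 2)) * Real.exp (-(z.re / 2) * u)) := by
            gcongr
            exact abs_mul_neg_log_add_le k hu'
        _ = _ := by ring
    · exact ((integrableOn_pow_mul_exp_neg (half_pos hz') 1).1.add
        (integrableOn_pow_mul_exp_neg (half_pos hz') 3).1).const_mul _
    · refine Eventually.of_forall fun u w _ => ?_
      have h1 : HasDerivAt (fun w : ℂ => Complex.exp (-w * u))
          (Complex.exp (-w * u) * (-1 * u)) w :=
        ((hasDerivAt_id w).neg.mul_const (u : ℂ)).cexp
      convert! h1.const_mul (((u * (-Real.log u + k) : ℝ) : ℂ)) using 1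
      simp only [hF]
      ring
  have hU : IsOpen {z : ℂ | 0 < z.re} := isOpen_lt continuous_const Complex.continuous_re
  have hA : AnalyticOnNhd ℂ (fun z => ∫ u in Set.Ioi (0 : ℝ), F z u) {z | 0 < z.re} :=
    hdiff.analyticOnNhd hU
  have hB : AnalyticOnNhd ℂ (fun z =>
      (Complex.log z + Real.eulerMascheroniConstant - 1 + k) / z ^ 2) {z | 0 < z.re} := by
    refine DifferentiableOn.analyticOnNhd (fun z hz => ?_) hU
    have hz' : 0 < z.re := hz
    have hz0 : z ≠ 0 := by rintro rfl; simp at hz'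
    have : DifferentiableAt ℂ Complex.log z := Complex.differentiableAt_log (Or.inl hz')
    exact DifferentiableAt.differentiableWithinAt (by fun_prop (disch := simpa using hz0))
  have hreal : ∀ r : ℝ, 0 < r → ∫ u in Set.Ioi (0 : ℝ), F r u =
      (Complex.log r + Real.eulerMascheroniConstant - 1 + k) / (r : ℂ) ^ 2 := by
    intro r hr
    obtain ⟨h1, h2⟩ := integral_mul_log_mul_exp_neg hr
    obtain ⟨h3, h4⟩ := integrableOn_pow_mul_exp_neg hr 1
    have h5 : ∀ u : ℝ, F r u = (k : ℂ) * ((u ^ 1 * Real.exp (-r * u) : ℝ) : ℂ) -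
        (u : ℂ) * Real.log u * Complex.exp (-r * u) := by
      intro u
      rw [hF]
      push_cast
      ring
    simp_rw [h5]
    have h6 : IntegrableOn (fun u : ℝ => (k : ℂ) * ((u ^ 1 * Real.exp (-r * u) : ℝ) : ℂ))
        (Set.Ioi 0) := (Integrable.ofReal (𝕜 := ℂ) h3).const_mul _
    rw [integral_sub h6 h1, integral_const_mul, integral_complex_ofReal, h4, h2]
    have hr0 : (r : ℂ) ≠ 0 := by exact_mod_cast hr.ne'
    push_cast
    field_simp
    simp
    ring
  have hfreq : ∃ᶠ z in 𝓝[≠] (1 : ℂ), ∫ u in Set.Ioi (0 : ℝ), F z u =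
      (Complex.log z + Real.eulerMascheroniConstant - 1 + k) / z ^ 2 := by
    have ht : Tendsto (fun r : ℝ => (r : ℂ)) (𝓝[>] 1) (𝓝[≠] 1) := by
      refine tendsto_nhdsWithin_iff.2 ⟨?_, ?_⟩
      · exact (Complex.continuous_ofReal.tendsto' 1 1 (by simp)).mono_left nhdsWithin_le_nhds
      · filter_upwards [self_mem_nhdsWithin] with r hr
        have : (1 : ℝ) < r := hr
        simp only [Set.mem_compl_iff, Set.mem_singleton_iff]
        exact_mod_cast this.ne'
    refine ht.frequently (Eventually.frequently ?_)
    filter_upwards [self_mem_nhdsWithin] with r hr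
    exact hreal r (zero_lt_one.trans hr)
  refine ⟨hFI s hs, ?_⟩
  exact hA.eqOn_of_preconnected_of_frequently_eq hB (convex_halfSpace_re_gt 0).isPreconnected
    (show (1 : ℂ) ∈ {z : ℂ | 0 < z.re} by simp) hfreq hs

/-- The Laplace transform of `1 - cos (t u)`; for `s = H + ia` the real parts of the two fractions are
Poisson kernels of width `H` centred at `a`. -/
theorem sq_mul_integral_one_sub_cos_mul_exp_neg {s : ℂ} (hs : 0 < s.re) (t : ℝ) :
    s ^ 2 * ∫ u in Set.Ioi (0 : ℝ), ((1 - Real.cos (t * u) : ℝ) : ℂ) * Complex.exp (-s * u) =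
      (t : ℂ) ^ 2 * ((1 / (s - t * Complex.I) + 1 / (s + t * Complex.I)) / 2) := by
  have hs0 : s ≠ 0 := by rintro rfl; simp at hs
  have h1 : 0 < (s - t * Complex.I).re := by simpa using hs
  have h2 : 0 < (s + t * Complex.I).re := by simpa using hs
  have h1' : s - t * Complex.I ≠ 0 := by intro h; rw [h] at h1; simp at h1
  have h2' : s + t * Complex.I ≠ 0 := by intro h; rw [h] at h2; simp at h2
  have hexp : ∀ z : ℂ, 0 < z.re → IntegrableOn (fun u : ℝ => Complex.exp (-z * u)) (Set.Ioi 0) ∧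
      ∫ u in Set.Ioi (0 : ℝ), Complex.exp (-z * u) = 1 / z := by
    intro z hz
    refine ⟨integrableOn_exp_mul_complex_Ioi (by simpa using hz) 0, ?_⟩
    rw [integral_exp_mul_complex_Ioi (by simpa using hz)]
    simp
  have hfun : ∀ u : ℝ, ((1 - Real.cos (t * u) : ℝ) : ℂ) * Complex.exp (-s * u) =
      Complex.exp (-s * u) - (1 / 2 : ℂ) * (Complex.exp (-(s - t * Complex.I) * u) +
        Complex.exp (-(s + t * Complex.I) * u)) := by
    intro u
    push_cast
    rw [Complex.cos]
    have e1 : Complex.exp (-(s - t * Complex.I) * u) =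
        Complex.exp (t * u * Complex.I) * Complex.exp (-s * u) := by
      rw [← Complex.exp_add]; ring_nf
    have e2 : Complex.exp (-(s + t * Complex.I) * u) =
        Complex.exp (-(t * u) * Complex.I) * Complex.exp (-s * u) := by
      rw [← Complex.exp_add]; ring_nf
    rw [e1, e2]
    ring
  simp_rw [hfun]
  have hadd : IntegrableOn (fun u : ℝ => Complex.exp (-(s - t * Complex.I) * u) +
      Complex.exp (-(s + t * Complex.I) * u)) (Set.Ioi 0) := (hexp _ h1).1.add (hexp _ h2).1
  rw [integral_sub (hexp s hs).1 (hadd.const_mul _), integral_const_mul,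
    integral_add (hexp _ h1).1 (hexp _ h2).1, (hexp s hs).2, (hexp _ h1).2, (hexp _ h2).2]
  field_simp
  have hI : Complex.I ^ 2 = -1 := Complex.I_sq
  linear_combination (-2 * (s * t ^ 2)) * hI

/-- The Poisson kernel of the half plane, up to the factor `1 / π`. -/
noncomputable def poissonKer (H x : ℝ) : ℝ := H / (H ^ 2 + x ^ 2)

theorem poissonKer_nonneg {H : ℝ} (hH : 0 ≤ H) (x : ℝ) : 0 ≤ poissonKer H x := by
  unfold poissonKer; positivity

theorem measurable_poissonKer (H : ℝ) : Measurable (poissonKer H) := by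
  unfold poissonKer
  exact measurable_const.div (by fun_prop)

theorem re_one_div_sub_mul_I (H a t : ℝ) :
    (1 / ((H : ℂ) + a * Complex.I - t * Complex.I)).re = poissonKer H (a - t) := by
  rw [one_div, Complex.inv_re, Complex.normSq_apply, poissonKer]
  simp
  ring_nf

theorem sq_mul_poissonKer_le {H : ℝ} (hH : 0 < H) (a t : ℝ) :
    t ^ 2 * poissonKer H (a - t) ≤ 2 * (a ^ 2 + H ^ 2) / H := by
  rw [poissonKer, mul_div_assoc', div_le_div_iff₀ (by positivity) hH]
  have h1 : t ^ 2 ≤ 2 * a ^ 2 + 2 * (a - t) ^ 2 := by nlinarith [sq_nonneg (2 * a - t)]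
  have h2 : 0 ≤ a ^ 2 * (a - t) ^ 2 := by positivity
  nlinarith [mul_le_mul_of_nonneg_left h1 (sq_nonneg H), sq_nonneg (a * H), sq_nonneg (H * H)]

theorem integrable_zetaDensity_mul_poissonKer {H : ℝ} (hH : 0 < H) (a : ℝ) :
    Integrable fun t => zetaDensity t * (t ^ 2 * poissonKer H (a - t)) := by
  refine integrable_zetaDensity_mul (k := fun t => t ^ 2 * poissonKer H (a - t))
    (C := 2 * (a ^ 2 + H ^ 2) / H) ?_ fun t => ?_
  · exact ((measurable_id.pow_const 2).mul ((measurable_poissonKer H).comp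
      (measurable_const.sub measurable_id))).aestronglyMeasurable
  · rw [abs_of_nonneg (mul_nonneg (sq_nonneg t) (poissonKer_nonneg hH.le _))]
    exact sq_mul_poissonKer_le hH a t

/-- The constant of the mean square: `|ζ(1/2 + it)|²` is `log t + meanConst` on average. -/
noncomputable def meanConst : ℝ := 2 * Real.eulerMascheroniConstant - Real.log (2 * Real.pi)

theorem integrable_prod_zetaDensity {s : ℂ} (hs : 0 < s.re) :
    Integrable (Function.uncurry fun t u : ℝ => (zetaDensity t : ℂ) *
      (((1 - Real.cos (t * u) : ℝ) : ℂ) * Complex.exp (-s * u)))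
      (volume.prod (volume.restrict (Set.Ioi 0))) := by
  have h1 : Integrable (fun u : ℝ => Complex.exp (-s * u)) (volume.restrict (Set.Ioi 0)) :=
    integrableOn_exp_mul_complex_Ioi (by simpa using hs) 0
  have h2 := (integrable_zetaDensity.ofReal (𝕜 := ℂ)).mul_prod h1
  have h3 := h2.mul_bdd (c := 2) (g := fun p : ℝ × ℝ => ((1 - Real.cos (p.1 * p.2) : ℝ) : ℂ))
    (by fun_prop) (Eventually.of_forall fun p => by
      rw [Complex.norm_real, Real.norm_eq_abs, abs_le]
      constructor <;> linarith [Real.neg_one_le_cos (p.1 * p.2), Real.cos_le_one (p.1 * p.2)])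
  refine h3.congr (Eventually.of_forall fun p => ?_)
  simp only [Function.uncurry, Complex.coe_algebraMap]
  ring

/-- The Laplace transform of `zetaCosTransform`, by Fubini's theorem. -/
theorem sq_mul_integral_zetaCosTransform {s : ℂ} (hs : 0 < s.re) :
    IntegrableOn (fun u : ℝ => (zetaCosTransform u : ℂ) * Complex.exp (-s * u)) (Set.Ioi 0) ∧
    s ^ 2 * ∫ u in Set.Ioi (0 : ℝ), (zetaCosTransform u : ℂ) * Complex.exp (-s * u) =
      ∫ t, (zetaDensity t : ℂ) * ((t : ℂ) ^ 2 *
        ((1 / (s - t * Complex.I) + 1 / (s + t * Complex.I)) / 2)) := by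
  have hprod := integrable_prod_zetaDensity hs
  have hinner : ∀ u : ℝ, ∫ t, (zetaDensity t : ℂ) *
      (((1 - Real.cos (t * u) : ℝ) : ℂ) * Complex.exp (-s * u)) =
      (zetaCosTransform u : ℂ) * Complex.exp (-s * u) := by
    intro u
    rw [zetaCosTransform, ← integral_complex_ofReal, ← integral_mul_const]
    refine integral_congr_ae (Eventually.of_forall fun t => ?_)
    push_cast
    ring
  constructor
  · have := hprod.integral_prod_right
    simp only [Function.uncurry] at this
    simp_rw [hinner] at this
    exact this
  · have := integral_integral_swap hprod
    simp_rw [hinner] at this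
    rw [← this, ← integral_const_mul]
    refine integral_congr_ae (Eventually.of_forall fun t => ?_)
    simp only
    rw [← sq_mul_integral_one_sub_cos_mul_exp_neg hs, integral_const_mul]
    ring

/-- Poisson means of `|ζ|²` (weighted by `t² / (t² + 1/4)`): taking real parts in the Laplace
transform of `zetaCosTransform` at `H + ia`. -/
theorem exists_abs_poisson_mean_sub_le : ∃ C : ℝ, 0 ≤ C ∧ ∀ H a : ℝ, 0 < H →
    |(∫ t, zetaDensity t * (t ^ 2 * poissonKer H (a - t))) -
      Real.pi * (1 / 2 * Real.log (a ^ 2 + H ^ 2) + meanConst)| ≤ C * (a ^ 2 + H ^ 2) / H ^ 3 := by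
  obtain ⟨C, hC0, hC⟩ := exists_abs_zetaCosTransform_sub_le
  refine ⟨2 * C, by positivity, fun H a hH => ?_⟩
  set s : ℂ := H + a * Complex.I with hsdef
  have hre : s.re = H := by simp [hsdef]
  have him : s.im = a := by simp [hsdef]
  have hs : 0 < s.re := by rw [hre]; exact hH
  have hs0 : s ≠ 0 := by rintro h; rw [h] at hs; simp at hs
  have hnsq : ‖s‖ ^ 2 = a ^ 2 + H ^ 2 := by
    rw [← Complex.normSq_eq_norm_sq, Complex.normSq_apply, hre, him]; ring
  obtain ⟨hRI, hR⟩ := sq_mul_integral_zetaCosTransform hs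
  obtain ⟨hLI, hL⟩ := integral_mul_neg_log_add_mul_exp_neg incrConst hs
  obtain ⟨hQI, hQ⟩ := integrableOn_pow_mul_exp_neg hH 2
  have heq : ∀ u : ℝ, ((Real.pi * (u * (-Real.log u + incrConst)) : ℝ) : ℂ) *
      Complex.exp (-s * u) =
      Real.pi * (((u * (-Real.log u + incrConst) : ℝ) : ℂ) * Complex.exp (-s * u)) := by
    intro u
    push_cast
    ring
  have hXI : IntegrableOn (fun u : ℝ => ((Real.pi * (u * (-Real.log u + incrConst)) : ℝ) : ℂ) *
      Complex.exp (-s * u)) (Set.Ioi 0) := by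
    simp_rw [heq]
    exact hLI.const_mul _
  have hX : s ^ 2 * ∫ u in Set.Ioi (0 : ℝ), ((Real.pi * (u * (-Real.log u + incrConst)) : ℝ) : ℂ) *
      Complex.exp (-s * u) = Real.pi * (Complex.log s + (meanConst : ℝ)) := by
    simp_rw [heq]
    rw [integral_const_mul, hL, incrConst, meanConst]
    field_simp
    push_cast
    ring
  have herr : ‖s ^ 2 * ((∫ u in Set.Ioi (0 : ℝ), (zetaCosTransform u : ℂ) * Complex.exp (-s * u)) -
      ∫ u in Set.Ioi (0 : ℝ), ((Real.pi * (u * (-Real.log u + incrConst)) : ℝ) : ℂ) *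
        Complex.exp (-s * u))‖ ≤ 2 * C * (a ^ 2 + H ^ 2) / H ^ 3 := by
    rw [← integral_sub hRI hXI, norm_mul, norm_pow, hnsq]
    have hb : ‖∫ u in Set.Ioi (0 : ℝ), ((zetaCosTransform u : ℂ) * Complex.exp (-s * u) -
        ((Real.pi * (u * (-Real.log u + incrConst)) : ℝ) : ℂ) * Complex.exp (-s * u))‖ ≤
        C * (((2 : ℕ).factorial : ℝ) / H ^ (2 + 1)) := by
      rw [← hQ, ← integral_const_mul]
      refine norm_integral_le_of_norm_le (hQI.const_mul C) ?_
      filter_upwards [ae_restrict_mem measurableSet_Ioi] with u hu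
      rw [← sub_mul, norm_mul, Complex.norm_exp, ← Complex.ofReal_sub, Complex.norm_real,
        Real.norm_eq_abs, ← mul_assoc C]
      have : (-s * (u : ℂ)).re = -H * u := by simp [hre]
      rw [this]
      exact mul_le_mul_of_nonneg_right (hC u hu) (Real.exp_pos _).le
    refine (mul_le_mul_of_nonneg_left hb (by positivity)).trans (le_of_eq ?_)
    norm_num [Nat.factorial]
    ring
  rw [mul_sub, hR, hX] at herr
  -- the real part of the left side; the two fractions contribute equally since the density is even
  have hreal : ((∫ t, (zetaDensity t : ℂ) * ((t : ℂ) ^ 2 *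
        ((1 / (s - t * Complex.I) + 1 / (s + t * Complex.I)) / 2))) -
        Real.pi * (Complex.log s + (meanConst : ℝ))).re =
      (∫ t, zetaDensity t * (t ^ 2 * poissonKer H (a - t))) -
      Real.pi * (1 / 2 * Real.log (a ^ 2 + H ^ 2) + meanConst) := by
    have hint : Integrable (fun t : ℝ => (zetaDensity t : ℂ) * ((t : ℂ) ^ 2 *
        ((1 / (s - t * Complex.I) + 1 / (s + t * Complex.I)) / 2))) := by
      have h0 := (integrable_prod_zetaDensity hs).integral_prod_left.const_mul (s ^ 2)
      refine h0.congr (Eventually.of_forall fun t => ?_)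
      simp only [Function.uncurry]
      rw [← sq_mul_integral_one_sub_cos_mul_exp_neg hs, integral_const_mul]
      ring
    have h1 : (∫ t, (zetaDensity t : ℂ) * ((t : ℂ) ^ 2 *
        ((1 / (s - t * Complex.I) + 1 / (s + t * Complex.I)) / 2))).re =
        ∫ t, (zetaDensity t * (t ^ 2 * poissonKer H (a - t)) +
          zetaDensity (-t) * ((-t) ^ 2 * poissonKer H (a - -t))) / 2 := by
      rw [← RCLike.re_to_complex, ← integral_re hint]
      refine integral_congr_ae (Eventually.of_forall fun t => ?_)
      simp only [RCLike.re_to_complex]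
      have e1 := re_one_div_sub_mul_I H a t
      have e2 := re_one_div_sub_mul_I H a (-t)
      rw [← hsdef] at e1 e2
      have e3 : s - ((-t : ℝ) : ℂ) * Complex.I = s + t * Complex.I := by push_cast; ring
      rw [e3] at e2
      have e4 : (zetaDensity t : ℂ) * ((t : ℂ) ^ 2 *
          ((1 / (s - t * Complex.I) + 1 / (s + t * Complex.I)) / 2)) =
          ((zetaDensity t * t ^ 2 / 2 : ℝ) : ℂ) *
            (1 / (s - t * Complex.I) + 1 / (s + t * Complex.I)) := by push_cast; ring
      rw [e4, Complex.re_ofReal_mul, Complex.add_re, e1, e2, zetaDensity_neg]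
      ring
    have h2 := integrable_zetaDensity_mul_poissonKer hH a
    rw [Complex.sub_re, h1, integral_div, integral_add h2 h2.comp_neg,
      integral_neg_eq_self (fun t => zetaDensity t * (t ^ 2 * poissonKer H (a - t)))]
    have h3 : ((Real.pi : ℂ) * (Complex.log s + (meanConst : ℝ))).re =
        Real.pi * (1 / 2 * Real.log (a ^ 2 + H ^ 2) + meanConst) := by
      rw [Complex.re_ofReal_mul, Complex.add_re, Complex.log_re, Complex.ofReal_re, ← hnsq,
        Real.log_pow]
      push_cast
      ring
    rw [h3]
    ring
  rw [← hreal]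
  exact (Complex.abs_re_le_norm _).trans herr

/-! ### Smoothed cut-offs -/

theorem arctan_sub_arctan_le {x y : ℝ} (h : x ≤ y) : Real.arctan y - Real.arctan x ≤ y - x := by
  have hm : Monotone fun x : ℝ => x - Real.arctan x := by
    refine monotone_of_deriv_nonneg (differentiable_id.sub Real.differentiable_arctan) fun x => ?_
    have := ((hasDerivAt_id x).sub (Real.hasDerivAt_arctan x)).deriv
    change 0 ≤ deriv (id - Real.arctan) x
    rw [this, sub_nonneg, div_le_one (by positivity)]
    nlinarith [sq_nonneg x]
  have := hm h
  simp only at this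
  linarith

/-- `∫_{-T}^{T} poissonKer H (a - t) da`, a smoothed version of `π` times the indicator of
`[-T, T]`. -/
noncomputable def smoothedIndicator (H T t : ℝ) : ℝ :=
  Real.arctan ((T - t) / H) + Real.arctan ((T + t) / H)

theorem integral_poissonKer {H : ℝ} (hH : 0 < H) (T t : ℝ) :
    ∫ a in (-T)..T, poissonKer H (a - t) = smoothedIndicator H T t := by
  have hd : ∀ a : ℝ, HasDerivAt (fun a => Real.arctan ((a - t) / H)) (poissonKer H (a - t)) a := by
    intro a
    have h1 : HasDerivAt (fun a : ℝ => (a - t) / H) (1 / H) a :=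
      ((hasDerivAt_id a).sub_const t).div_const H
    convert! h1.arctan using 1
    rw [poissonKer]
    field_simp
  have hc : Continuous fun a => poissonKer H (a - t) := by
    unfold poissonKer
    exact continuous_const.div (by fun_prop) fun a => by positivity
  rw [intervalIntegral.integral_eq_sub_of_hasDerivAt (fun a _ => hd a) (hc.intervalIntegrable _ _),
    smoothedIndicator, show (-T - t) / H = -((T + t) / H) by ring, Real.arctan_neg]
  ring

theorem smoothedIndicator_neg (H T t : ℝ) :
    smoothedIndicator H T (-t) = smoothedIndicator H T t := by
  rw [smoothedIndicator, smoothedIndicator, sub_neg_eq_add, ← sub_eq_add_neg, add_comm]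

theorem abs_smoothedIndicator_le (H T t : ℝ) : |smoothedIndicator H T t| ≤ Real.pi := by
  have h1 := Real.arctan_lt_pi_div_two ((T - t) / H)
  have h2 := Real.arctan_lt_pi_div_two ((T + t) / H)
  have h3 := Real.neg_pi_div_two_lt_arctan ((T - t) / H)
  have h4 := Real.neg_pi_div_two_lt_arctan ((T + t) / H)
  rw [smoothedIndicator, abs_le]
  constructor <;> linarith

theorem smoothedIndicator_nonneg {H T : ℝ} (hH : 0 < H) (hT : 0 ≤ T) (t : ℝ) :
    0 ≤ smoothedIndicator H T t := by
  rw [← integral_poissonKer hH]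
  exact intervalIntegral.integral_nonneg (by linarith) fun a _ => poissonKer_nonneg hH.le _

/-- Away from `[-T, T]` the smoothed indicator of `[-(T - L), T - L]` is dominated by a Poisson
kernel of width `T`. -/
theorem smoothedIndicator_sub_le {H L T : ℝ} (hH : 0 < H) (hL : 0 < L) (hLT : L < T) {t : ℝ}
    (ht : T < t) : smoothedIndicator H (T - L) t ≤ 4 * H * T / L * poissonKer T t := by
  have hT : 0 < T := hL.trans hLT
  have ht0 : 0 < t := hT.trans ht
  set x₁ : ℝ := (t - (T - L)) / H with hx₁
  set x₂ : ℝ := (t + (T - L)) / H with hx₂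
  have hx₁0 : 0 < x₁ := div_pos (by linarith) hH
  have hx₂0 : 0 < x₂ := div_pos (by linarith) hH
  have hle : x₁ ≤ x₂ := by rw [hx₁, hx₂]; gcongr; linarith
  have h1 : smoothedIndicator H (T - L) t = Real.arctan x₁⁻¹ - Real.arctan x₂⁻¹ := by
    rw [Real.arctan_inv_of_pos hx₁0, Real.arctan_inv_of_pos hx₂0, smoothedIndicator,
      show (T - L - t) / H = -x₁ by rw [hx₁]; ring, show (T - L + t) / H = x₂ by rw [hx₂]; ring,
      Real.arctan_neg]
    ring
  rw [h1]
  refine (arctan_sub_arctan_le (inv_anti₀ hx₁0 hle)).trans ?_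
  have e1 : 0 < t - (T - L) := by linarith
  have e2 : 0 < t + (T - L) := by linarith
  have h2 : x₁⁻¹ - x₂⁻¹ = 2 * H * (T - L) / ((t - (T - L)) * (t + (T - L))) := by
    rw [hx₁, hx₂]
    field_simp
    ring
  have h3 : L / T * t * t ≤ (t - (T - L)) * (t + (T - L)) := by
    have e3 : L / T * t ≤ t - (T - L) := by
      rw [div_mul_eq_mul_div, div_le_iff₀ hT]
      nlinarith
    exact mul_le_mul e3 (by linarith) ht0.le e1.le
  rw [h2]
  calc 2 * H * (T - L) / ((t - (T - L)) * (t + (T - L)))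
      ≤ 2 * H * T / (L / T * t * t) := by
        gcongr
        linarith
    _ = 4 * H * T / L * (T / (2 * t ^ 2)) := by field_simp; ring
    _ ≤ _ := by
        rw [poissonKer]
        gcongr
        nlinarith

/-- Lower half of the sandwich: moving the cut-off inwards by `L` leaves only the tails, which a
Poisson kernel of width `T` absorbs. -/
theorem smoothedIndicator_sub_le_indicator_add {H L T : ℝ} (hH : 0 < H) (hL : 0 < L) (hLT : L < T)
    (t : ℝ) : smoothedIndicator H (T - L) t ≤
      (Set.Icc (-T) T).indicator (fun _ => Real.pi) t + 4 * H * T / L * poissonKer T t := by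
  have hT : 0 < T := hL.trans hLT
  have hP : 0 ≤ 4 * H * T / L * poissonKer T t :=
    mul_nonneg (by positivity) (poissonKer_nonneg hT.le t)
  by_cases ht : t ∈ Set.Icc (-T) T
  · rw [Set.indicator_of_mem ht]
    linarith [(abs_le.1 (abs_smoothedIndicator_le H (T - L) t)).2]
  · rw [Set.indicator_of_notMem ht, zero_add]
    rw [Set.mem_Icc, not_and_or, not_le, not_le] at ht
    rcases ht with ht | ht
    · have := smoothedIndicator_sub_le hH hL hLT (t := -t) (by linarith)
      rw [smoothedIndicator_neg, poissonKer, neg_sq] at this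
      exact this
    · exact smoothedIndicator_sub_le hH hL hLT ht

/-- Upper half of the sandwich: on `[-T, T]` the smoothed indicator of `[-(T + L), T + L]` falls short
of `π` by at most `2 H / L`. -/
theorem indicator_le_smoothedIndicator_add {H L T : ℝ} (hH : 0 < H) (hL : 0 < L) (hT : 0 < T)
    (t : ℝ) : (Set.Icc (-T) T).indicator (fun _ => Real.pi) t ≤
      smoothedIndicator H (T + L) t + 4 * H * T / L * poissonKer T t := by
  by_cases ht : t ∈ Set.Icc (-T) T
  · rw [Set.indicator_of_mem ht]
    have key : ∀ x : ℝ, L ≤ x → Real.pi / 2 - H / L ≤ Real.arctan (x / H) := by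
      intro x hx
      have h1 : Real.arctan (L / H) ≤ Real.arctan (x / H) :=
        Real.arctan_strictMono.monotone (by gcongr)
      have h2 := Real.arctan_inv_of_pos (show 0 < L / H by positivity)
      have h3 := arctan_sub_arctan_le (show (0 : ℝ) ≤ H / L by positivity)
      rw [inv_div] at h2
      rw [Real.arctan_zero] at h3
      linarith
    have h1 := key (T + L - t) (by linarith [ht.2])
    have h2 := key (T + L + t) (by linarith [ht.1])
    have h3 : 2 * (H / L) ≤ 4 * H * T / L * poissonKer T t := by
      have e1 : t ^ 2 ≤ T ^ 2 := sq_le_sq' ht.1 ht.2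
      have e2 : T / (2 * T ^ 2) ≤ poissonKer T t := by
        rw [poissonKer]
        gcongr
        linarith
      have e3 : 2 * (H / L) = 4 * H * T / L * (T / (2 * T ^ 2)) := by field_simp; ring
      rw [e3]
      gcongr
    rw [smoothedIndicator]
    linarith
  · rw [Set.indicator_of_notMem ht]
    exact add_nonneg (smoothedIndicator_nonneg hH (by linarith) t)
      (mul_nonneg (by positivity) (poissonKer_nonneg hT.le t))

theorem integrable_prod_poissonKer {H : ℝ} (hH : 0 < H) (T : ℝ) :
    Integrable (Function.uncurry fun t a : ℝ => zetaDensity t * (t ^ 2 * poissonKer H (a - t)))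
      (volume.prod (volume.restrict (Set.Ioc (-T) T))) := by
  have hc : Continuous fun a : ℝ => 2 * (a ^ 2 + H ^ 2) / H := by fun_prop
  have h1 : Integrable (fun a : ℝ => 2 * (a ^ 2 + H ^ 2) / H)
      (volume.restrict (Set.Ioc (-T) T)) :=
    (hc.integrableOn_Icc (a := -T) (b := T)).mono_set Set.Ioc_subset_Icc_self
  refine (integrable_zetaDensity.mul_prod h1).mono' ?_ (Eventually.of_forall fun p => ?_)
  · refine AEStronglyMeasurable.mul ?_ ?_
    · exact integrable_zetaDensity.aestronglyMeasurable.comp_fst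
    · refine Measurable.aestronglyMeasurable ?_
      exact (measurable_fst.pow_const 2).mul
        ((measurable_poissonKer H).comp (measurable_snd.sub measurable_fst))
  · simp only [Function.uncurry]
    rw [Real.norm_of_nonneg (mul_nonneg (zetaDensity_nonneg _)
      (mul_nonneg (sq_nonneg _) (poissonKer_nonneg hH.le _)))]
    exact mul_le_mul_of_nonneg_left (sq_mul_poissonKer_le hH _ _) (zetaDensity_nonneg _)

/-- Averaging the Poisson means over their centres `a ∈ [-T, T]` produces the smoothed cut-off. -/
theorem integral_integral_poissonKer {H T : ℝ} (hH : 0 < H) (hT : 0 ≤ T) :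
    IntervalIntegrable (fun a => ∫ t, zetaDensity t * (t ^ 2 * poissonKer H (a - t)))
      volume (-T) T ∧
    ∫ a in (-T)..T, ∫ t, zetaDensity t * (t ^ 2 * poissonKer H (a - t)) =
      ∫ t, zetaDensity t * (t ^ 2 * smoothedIndicator H T t) := by
  have hp := integrable_prod_poissonKer hH T
  constructor
  · rw [intervalIntegrable_iff_integrableOn_Ioc_of_le (by linarith)]
    exact hp.integral_prod_right
  · rw [intervalIntegral.integral_of_le (by linarith), ← integral_integral_swap hp]
    refine integral_congr_ae (Eventually.of_forall fun t => ?_)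
    simp only
    rw [integral_const_mul, integral_const_mul, ← intervalIntegral.integral_of_le (by linarith),
      integral_poissonKer hH]

theorem integrable_zetaDensity_mul_smoothedIndicator {H T : ℝ} (hH : 0 < H) (hT : 0 ≤ T) :
    Integrable fun t => zetaDensity t * (t ^ 2 * smoothedIndicator H T t) := by
  refine (integrable_prod_poissonKer hH T).integral_prod_left.congr
    (Eventually.of_forall fun t => ?_)
  simp only [Function.uncurry]
  rw [integral_const_mul, integral_const_mul, ← intervalIntegral.integral_of_le (by linarith),
      integral_poissonKer hH]

/-- The main term of the mean square over `[-T, T]`, namely `∫ (log |a| + meanConst) da`. -/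
noncomputable def meanSqMain (T : ℝ) : ℝ := 2 * (T * Real.log T) + 2 * (meanConst - 1) * T

theorem abs_integral_log_add_sq_sub_le {H T : ℝ} (hH : 1 ≤ H) (hT : H ≤ T) :
    |(∫ a in (-T)..T, (1 / 2 * Real.log (a ^ 2 + H ^ 2) + meanConst)) - meanSqMain T| ≤
      2 * H * (1 + Real.log (2 * T)) := by
  have hH0 : 0 < H := by linarith
  have hT0 : 0 < T := by linarith
  have hcont : Continuous fun a : ℝ => 1 / 2 * Real.log (a ^ 2 + H ^ 2) := by
    fun_prop (disch := intro a; positivity)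
  have hcont2 : Continuous fun a : ℝ => Real.log (|a| + H) := by
    fun_prop (disch := intro a; positivity)
  have hlog : IntervalIntegrable Real.log volume (-T) T := intervalIntegral.intervalIntegrable_log'
  rw [intervalIntegral.integral_add (hcont.intervalIntegrable _ _) intervalIntegrable_const,
    intervalIntegral.integral_const, smul_eq_mul]
  -- `log |a| ≤ log √(a² + H²) ≤ log (|a| + H)`, and the outer two integrals are elementary
  have hlow : ∫ a in (-T)..T, Real.log a ≤ ∫ a in (-T)..T, 1 / 2 * Real.log (a ^ 2 + H ^ 2) := by
    refine intervalIntegral.integral_mono_on_of_le_Ioo (by linarith) hlog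
      (hcont.intervalIntegrable _ _) fun a _ => ?_
    rcases eq_or_ne a 0 with rfl | ha
    · rw [Real.log_zero]
      have : 0 ≤ Real.log (0 ^ 2 + H ^ 2) := Real.log_nonneg (by nlinarith)
      exact mul_nonneg (by norm_num) this
    · have h1 : Real.log (a ^ 2) ≤ Real.log (a ^ 2 + H ^ 2) :=
        Real.log_le_log (by positivity) (by nlinarith)
      rw [Real.log_pow] at h1
      push_cast at h1
      linarith
  have hup : ∫ a in (-T)..T, 1 / 2 * Real.log (a ^ 2 + H ^ 2) ≤
      ∫ a in (-T)..T, Real.log (|a| + H) := by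
    refine intervalIntegral.integral_mono_on_of_le_Ioo (by linarith)
      (hcont.intervalIntegrable _ _) (hcont2.intervalIntegrable _ _) fun a _ => ?_
    have h0 := abs_nonneg a
    have h1 : Real.log (a ^ 2 + H ^ 2) ≤ Real.log ((|a| + H) ^ 2) :=
      Real.log_le_log (by positivity) (by rw [← sq_abs a]; nlinarith)
    rw [Real.log_pow] at h1
    push_cast at h1
    linarith
  have hlogval : ∫ a in (-T)..T, Real.log a = 2 * (T * Real.log T - T) := by
    rw [integral_log, Real.log_neg_eq_log]
    ring
  have hhalf : ∫ a in (0 : ℝ)..T, Real.log (|a| + H) =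
      (T + H) * Real.log (T + H) - H * Real.log H - T := by
    have e1 : ∫ a in (0 : ℝ)..T, Real.log (|a| + H) = ∫ a in (0 : ℝ)..T, Real.log (a + H) := by
      refine intervalIntegral.integral_congr fun a ha => ?_
      rw [Set.uIcc_of_le hT0.le] at ha
      simp only [abs_of_nonneg ha.1]
    rw [e1, intervalIntegral.integral_comp_add_right (fun x => Real.log x), integral_log]
    ring_nf
  have hupval : ∫ a in (-T)..T, Real.log (|a| + H) =
      2 * ((T + H) * Real.log (T + H) - H * Real.log H - T) := by
    have e1 : ∫ a in (-T)..(0 : ℝ), Real.log (|a| + H) = ∫ a in (0 : ℝ)..T, Real.log (|a| + H) := by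
      have := intervalIntegral.integral_comp_neg (a := 0) (b := T) (fun a => Real.log (|a| + H))
      simp only [abs_neg, neg_zero] at this
      exact this.symm
    rw [← intervalIntegral.integral_add_adjacent_intervals (hcont2.intervalIntegrable (-T) 0)
      (hcont2.intervalIntegrable 0 T), e1, hhalf]
    ring
  have h1 : T * (Real.log (T + H) - Real.log T) ≤ H := by
    rw [← Real.log_div (by positivity) hT0.ne']
    have := Real.log_le_sub_one_of_pos (show 0 < (T + H) / T by positivity)
    calc T * Real.log ((T + H) / T) ≤ T * ((T + H) / T - 1) := by gcongr
      _ = H := by field_simp; ring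
  have h2 : Real.log (T + H) ≤ Real.log (2 * T) := Real.log_le_log (by linarith) (by linarith)
  have h3 : 0 ≤ Real.log H := Real.log_nonneg hH
  have h4 : 0 ≤ Real.log (2 * T) := Real.log_nonneg (by linarith)
  have h5 : 0 ≤ H * Real.log H := by positivity
  have h6 : H * Real.log (T + H) ≤ H * Real.log (2 * T) := by gcongr
  have h7 : 0 ≤ H * Real.log (2 * T) := by positivity
  rw [meanSqMain, abs_le]
  constructor
  · nlinarith
  · nlinarith

/-- The mean square with the smoothed cut-off. -/
theorem exists_abs_integral_smoothedIndicator_sub_le : ∃ C : ℝ, 0 ≤ C ∧ ∀ H T : ℝ, 1 ≤ H → H ≤ T →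
    |(∫ t, zetaDensity t * (t ^ 2 * smoothedIndicator H T t)) - Real.pi * meanSqMain T| ≤
      C * (H * (1 + Real.log (2 * T)) + T ^ 3 / H ^ 3) := by
  obtain ⟨C, hC0, hC⟩ := exists_abs_poisson_mean_sub_le
  have hpi := Real.pi_pos
  refine ⟨2 * Real.pi + 4 * C, by positivity, fun H T hH hT => ?_⟩
  have hH0 : 0 < H := by linarith
  have hT0 : 0 < T := by linarith
  obtain ⟨hI, hE⟩ := integral_integral_poissonKer hH0 hT0.le
  have hcont : Continuous fun a : ℝ => 1 / 2 * Real.log (a ^ 2 + H ^ 2) + meanConst := by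
    fun_prop (disch := intro a; positivity)
  have h1 := abs_integral_log_add_sq_sub_le hH hT
  have h2 : |(∫ a in (-T)..T, ∫ t, zetaDensity t * (t ^ 2 * poissonKer H (a - t))) -
      Real.pi * ∫ a in (-T)..T, (1 / 2 * Real.log (a ^ 2 + H ^ 2) + meanConst)| ≤
      4 * C * (T ^ 3 / H ^ 3) := by
    rw [← intervalIntegral.integral_const_mul, ← intervalIntegral.integral_sub hI
      ((hcont.const_mul _).intervalIntegrable _ _), ← Real.norm_eq_abs]
    have hb : ∀ a ∈ Set.uIoc (-T) T, ‖(∫ t, zetaDensity t * (t ^ 2 * poissonKer H (a - t))) -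
        Real.pi * (1 / 2 * Real.log (a ^ 2 + H ^ 2) + meanConst)‖ ≤ C * (2 * T ^ 2) / H ^ 3 := by
      intro a ha
      rw [Set.uIoc_of_le (by linarith)] at ha
      refine (hC H a hH0).trans ?_
      have e1 : a ^ 2 ≤ T ^ 2 := sq_le_sq' ha.1.le ha.2
      have e2 : H ^ 2 ≤ T ^ 2 := by gcongr
      gcongr
      linarith
    refine (intervalIntegral.norm_integral_le_of_norm_le_const hb).trans (le_of_eq ?_)
    rw [abs_of_pos (by linarith)]
    ring
  rw [hE] at h2
  set A : ℝ := ∫ t, zetaDensity t * (t ^ 2 * smoothedIndicator H T t)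
  set B : ℝ := ∫ a in (-T)..T, (1 / 2 * Real.log (a ^ 2 + H ^ 2) + meanConst)
  have h3 : A - Real.pi * meanSqMain T = (A - Real.pi * B) + Real.pi * (B - meanSqMain T) := by ring
  have h4 : |Real.pi * (B - meanSqMain T)| ≤ Real.pi * (2 * H * (1 + Real.log (2 * T))) := by
    rw [abs_mul, abs_of_pos hpi]
    gcongr
  have h5 : 0 ≤ Real.log (2 * T) := Real.log_nonneg (by linarith)
  have h6 : 0 ≤ C * (H * (1 + Real.log (2 * T))) := by positivity
  have h7 : 0 ≤ Real.pi * (T ^ 3 / H ^ 3) := by positivity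
  rw [h3]
  refine (abs_add_le _ _).trans ?_
  linarith

/-! ### The mean square on the critical line -/

theorem abs_meanSqMain_sub_le {x y : ℝ} (hx : 1 ≤ x) (hxy : x ≤ y) :
    |meanSqMain y - meanSqMain x| ≤ 2 * (y - x) * (1 + Real.log y + |meanConst - 1|) := by
  have hx0 : 0 < x := by linarith
  have hy0 : 0 < y := by linarith
  have h1 : 0 ≤ Real.log y - Real.log x := by
    rw [sub_nonneg]; exact Real.log_le_log hx0 hxy
  have h2 : x * (Real.log y - Real.log x) ≤ y - x := by
    rw [← Real.log_div hy0.ne' hx0.ne']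
    have := Real.log_le_sub_one_of_pos (show 0 < y / x by positivity)
    calc x * Real.log (y / x) ≤ x * (y / x - 1) := by gcongr
      _ = y - x := by field_simp
  have h3 : 0 ≤ Real.log y := Real.log_nonneg (by linarith)
  have h4 : meanSqMain y - meanSqMain x = 2 * (x * (Real.log y - Real.log x)) +
      2 * ((y - x) * Real.log y) + 2 * ((y - x) * (meanConst - 1)) := by
    rw [meanSqMain, meanSqMain]; ring
  have hd : 0 ≤ y - x := by linarith
  rw [h4]
  refine (abs_add_three _ _ _).trans ?_
  rw [abs_of_nonneg (by positivity : 0 ≤ 2 * (x * (Real.log y - Real.log x))),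
    abs_of_nonneg (by positivity : 0 ≤ 2 * ((y - x) * Real.log y)), abs_mul, abs_mul,
    abs_of_nonneg hd, abs_two]
  nlinarith

/-- The mean square of `ζ(1/2 + it)` over `[-T, T]`, weighted by `t² / (t² + 1/4)`. The weight makes
the integrand `t² |ζ(s) / s|²` and costs only `O(1)`. -/
noncomputable def dampedMeanSq (T : ℝ) : ℝ := ∫ t in (-T)..T, zetaDensity t * t ^ 2

theorem integrable_zetaDensity_mul_indicator (T : ℝ) :
    Integrable fun t => zetaDensity t *
      (t ^ 2 * (Set.Icc (-T) T).indicator (fun _ => Real.pi) t) := by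
  have hm : Measurable fun t : ℝ => t ^ 2 * (Set.Icc (-T) T).indicator (fun _ => Real.pi) t :=
    (measurable_id.pow_const 2).mul (measurable_const.indicator measurableSet_Icc)
  refine integrable_zetaDensity_mul hm.aestronglyMeasurable (C := T ^ 2 * Real.pi) fun t => ?_
  have hpi := Real.pi_pos
  by_cases ht : t ∈ Set.Icc (-T) T
  · rw [Set.indicator_of_mem ht, abs_of_nonneg (by positivity)]
    have : t ^ 2 ≤ T ^ 2 := sq_le_sq' ht.1 ht.2
    gcongr
  · rw [Set.indicator_of_notMem ht, mul_zero, abs_zero]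
    positivity

theorem integral_zetaDensity_mul_indicator {T : ℝ} (hT : 0 ≤ T) :
    ∫ t, zetaDensity t * (t ^ 2 * (Set.Icc (-T) T).indicator (fun _ => Real.pi) t) =
      Real.pi * dampedMeanSq T := by
  rw [dampedMeanSq, intervalIntegral.integral_of_le (by linarith), ← integral_Icc_eq_integral_Ioc,
    ← integral_indicator measurableSet_Icc, ← integral_const_mul]
  refine integral_congr_ae (Eventually.of_forall fun t => ?_)
  by_cases ht : t ∈ Set.Icc (-T) T
  · simp only [Set.indicator_of_mem ht]
    ring
  · simp only [Set.indicator_of_notMem ht, mul_zero]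

theorem integral_zetaDensity_mul_le {k₁ k₂ k₃ : ℝ → ℝ} {c : ℝ}
    (h₁ : Integrable fun t => zetaDensity t * (t ^ 2 * k₁ t))
    (h₂ : Integrable fun t => zetaDensity t * (t ^ 2 * k₂ t))
    (h₃ : Integrable fun t => zetaDensity t * (t ^ 2 * k₃ t))
    (h : ∀ t, k₁ t ≤ k₂ t + c * k₃ t) :
    ∫ t, zetaDensity t * (t ^ 2 * k₁ t) ≤
      (∫ t, zetaDensity t * (t ^ 2 * k₂ t)) + c * ∫ t, zetaDensity t * (t ^ 2 * k₃ t) := by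
  rw [← integral_const_mul, ← integral_add h₂ (h₃.const_mul c)]
  refine integral_mono h₁ (h₂.add (h₃.const_mul c)) fun t => ?_
  have : zetaDensity t * (t ^ 2 * k₁ t) ≤ zetaDensity t * (t ^ 2 * (k₂ t + c * k₃ t)) :=
    mul_le_mul_of_nonneg_left (mul_le_mul_of_nonneg_left (h t) (sq_nonneg t)) (zetaDensity_nonneg t)
  refine this.trans (le_of_eq ?_)
  ring

/-- The mean square with a power saving. With `T = R ^ 8`, a smoothing of width `H = R ^ 6` and a shift
of the cut-off by `L = R ^ 7`, the errors `H log T`, `T³ / H³`, `L log T` and `(H T / L) log T` are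
all `O(R ^ 7 log R)`. -/
theorem exists_abs_dampedMeanSq_sub_le : ∃ K : ℝ, ∀ R : ℝ, 2 ≤ R →
    |dampedMeanSq (R ^ 8) - meanSqMain (R ^ 8)| ≤ K * (R ^ 7 * (1 + Real.log R)) := by
  obtain ⟨C₁, hC₁0, hC₁⟩ := exists_abs_poisson_mean_sub_le
  obtain ⟨C₂, hC₂0, hC₂⟩ := exists_abs_integral_smoothedIndicator_sub_le
  have hpi := Real.pi_pos
  set κ : ℝ := |meanConst| with hκ
  set ν : ℝ := |meanConst - 1| with hν
  have hκ0 : 0 ≤ κ := abs_nonneg _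
  have hν0 : 0 ≤ ν := abs_nonneg _
  refine ⟨(4 * (Real.pi * (8 + κ) + C₁) + 17 * C₂ + Real.pi * (2 * (9 + ν))) / Real.pi,
    fun R hR => ?_⟩
  have hR0 : 0 < R := by linarith
  set T : ℝ := R ^ 8 with hT
  set H : ℝ := R ^ 6 with hH
  set L : ℝ := R ^ 7 with hL
  set l : ℝ := 1 + Real.log R with hl
  have hlogR : 0 ≤ Real.log R := Real.log_nonneg (by linarith)
  have hl1 : 1 ≤ l := by linarith
  have hH1 : 1 ≤ H := one_le_pow₀ (by linarith)
  have hHL : 2 * H ≤ L := by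
    rw [hH, hL, pow_succ R 6]; nlinarith
  have hLT : 2 * L ≤ T := by
    rw [hT, hL, pow_succ R 7]; nlinarith
  have hH0 : 0 < H := by linarith
  have hL0 : 0 < L := by linarith
  have hT0 : 0 < T := by linarith
  have hlogT : Real.log T = 8 * Real.log R := by rw [hT, Real.log_pow]; norm_num
  have hlog2 : Real.log 2 ≤ 1 := by linarith [Real.log_two_lt_d9]
  have hlog4T : Real.log (4 * T) ≤ 8 * l := by
    rw [Real.log_mul (by norm_num) hT0.ne', hlogT, show (4 : ℝ) = 2 ^ 2 by norm_num, Real.log_pow]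
    push_cast
    linarith
  -- the contribution of the Poisson kernel of width `T`
  set E : ℝ := 4 * H * T / L * ∫ t, zetaDensity t * (t ^ 2 * poissonKer T t) with hE
  have hPI := integrable_zetaDensity_mul_poissonKer hT0 0
  have hP := hC₁ T 0 hT0
  have hP0 : ∀ t, poissonKer T (0 - t) = poissonKer T t := by
    intro t; rw [zero_sub, poissonKer, neg_sq, poissonKer]
  simp only [hP0] at hPI hP
  have hEle : E ≤ 4 * (Real.pi * (8 + κ) + C₁) * (L * l) := by
    have e1 : 4 * H * T / L = 4 * L := by rw [hH, hT, hL]; field_simp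
    have e2 : C₁ * (0 ^ 2 + T ^ 2) / T ^ 3 ≤ C₁ := by
      rw [zero_pow two_ne_zero, zero_add, div_le_iff₀ (by positivity)]
      have : T ^ 2 ≤ T ^ 3 := pow_le_pow_right₀ (by linarith) (by norm_num)
      gcongr
    have e3 : Real.log (0 ^ 2 + T ^ 2) = 2 * (8 * Real.log R) := by
      rw [zero_pow two_ne_zero, zero_add, Real.log_pow, hlogT]; norm_num
    rw [e3] at hP
    have e4 := (abs_le.1 (hP.trans e2)).2
    have e5 : meanConst ≤ κ := le_abs_self _
    have e6 : Real.pi * (1 / 2 * (2 * (8 * Real.log R)) + meanConst) ≤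
        Real.pi * ((8 + κ) * l) := by
      refine mul_le_mul_of_nonneg_left ?_ hpi.le
      nlinarith
    have e7 : C₁ ≤ C₁ * l := le_mul_of_one_le_right hC₁0 hl1
    rw [hE, e1]
    calc 4 * L * ∫ t, zetaDensity t * (t ^ 2 * poissonKer T t)
        ≤ 4 * L * (Real.pi * ((8 + κ) * l) + C₁ * l) := by
          gcongr
          linarith
      _ = _ := by ring
  -- the smoothed means
  have hA : ∀ U : ℝ, H ≤ U → U ≤ 2 * T →
      |(∫ t, zetaDensity t * (t ^ 2 * smoothedIndicator H U t)) - Real.pi * meanSqMain U| ≤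
        17 * C₂ * (L * l) := by
    intro U hU1 hU2
    refine (hC₂ H U hH1 hU1).trans ?_
    have e1 : Real.log (2 * U) ≤ 8 * l :=
      (Real.log_le_log (by linarith) (by linarith)).trans hlog4T
    have e2 : U ^ 3 / H ^ 3 ≤ 8 * H := by
      rw [div_le_iff₀ (by positivity)]
      calc U ^ 3 ≤ (2 * T) ^ 3 := by gcongr; linarith
        _ = 8 * H * H ^ 3 := by rw [hT, hH]; ring
    have e3 : H * (1 + Real.log (2 * U)) + U ^ 3 / H ^ 3 ≤ 17 * (L * l) := by
      have e4 : H * (1 + Real.log (2 * U)) ≤ H * (1 + 8 * l) := by gcongr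
      have e5 : H * l ≤ L * l := by gcongr; linarith
      nlinarith
    calc _ ≤ C₂ * (17 * (L * l)) := by gcongr
      _ = _ := by ring
  have hup := hA (T + L) (by linarith) (by linarith)
  have hlow := hA (T - L) (by linarith) (by linarith)
  -- moving the cut-off
  have hM : ∀ x y : ℝ, 1 ≤ x → x ≤ y → y - x = L → y ≤ 2 * T →
      |meanSqMain y - meanSqMain x| ≤ 2 * (9 + ν) * (L * l) := by
    intro x y hx hxy hd hy
    refine (abs_meanSqMain_sub_le hx hxy).trans ?_
    rw [hd]
    have e1 : Real.log y ≤ 8 * l :=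
      (Real.log_le_log (by linarith) (by linarith)).trans hlog4T
    have e2 : ν ≤ ν * l := le_mul_of_one_le_right hν0 hl1
    calc 2 * L * (1 + Real.log y + ν) ≤ 2 * L * (l + 8 * l + ν * l) := by
          gcongr
      _ = _ := by ring
  have hM1 := hM T (T + L) (by linarith) (by linarith) (by ring) (by linarith)
  have hM2 := hM (T - L) T (by linarith) (by linarith) (by ring) (by linarith)
  -- the sandwich
  have hs1 : Real.pi * dampedMeanSq T ≤
      (∫ t, zetaDensity t * (t ^ 2 * smoothedIndicator H (T + L) t)) + E := by
    rw [← integral_zetaDensity_mul_indicator hT0.le]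
    exact integral_zetaDensity_mul_le (integrable_zetaDensity_mul_indicator T)
      (integrable_zetaDensity_mul_smoothedIndicator hH0 (by linarith)) hPI
      (indicator_le_smoothedIndicator_add hH0 hL0 hT0)
  have hs2 : (∫ t, zetaDensity t * (t ^ 2 * smoothedIndicator H (T - L) t)) ≤
      Real.pi * dampedMeanSq T + E := by
    rw [← integral_zetaDensity_mul_indicator hT0.le]
    exact integral_zetaDensity_mul_le
      (integrable_zetaDensity_mul_smoothedIndicator hH0 (by linarith))
      (integrable_zetaDensity_mul_indicator T) hPI
      (smoothedIndicator_sub_le_indicator_add hH0 hL0 (by linarith))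
  rw [abs_le] at hup hlow hM1 hM2
  have hm1 := mul_le_mul_of_nonneg_left hM1.2 hpi.le
  have hm2 := mul_le_mul_of_nonneg_left hM2.2 hpi.le
  rw [mul_sub] at hm1 hm2
  have hsplit : (4 * (Real.pi * (8 + κ) + C₁) + 17 * C₂ + Real.pi * (2 * (9 + ν))) * (L * l) =
      4 * (Real.pi * (8 + κ) + C₁) * (L * l) + 17 * C₂ * (L * l) +
        Real.pi * (2 * (9 + ν) * (L * l)) := by ring
  have hfin : |Real.pi * (dampedMeanSq T - meanSqMain T)| ≤
      (4 * (Real.pi * (8 + κ) + C₁) + 17 * C₂ + Real.pi * (2 * (9 + ν))) * (L * l) := by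
    rw [hsplit, mul_sub, abs_le]
    constructor
    · linarith [hlow.1]
    · linarith [hup.2]
  rw [abs_mul, abs_of_pos hpi, mul_comm] at hfin
  rw [div_mul_eq_mul_div, le_div_iff₀ hpi]
  exact hfin

theorem tendsto_dampedMeanSq_div :
    Tendsto (fun T : ℝ => dampedMeanSq T / T - (2 * Real.log T + 2 * (meanConst - 1)))
      atTop (𝓝 0) := by
  obtain ⟨K, hK⟩ := exists_abs_dampedMeanSq_sub_le
  have hR : Tendsto (fun T : ℝ => T ^ ((8 : ℕ) : ℝ)⁻¹) atTop atTop :=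
    tendsto_rpow_atTop (by positivity)
  have h0 : Tendsto (fun R : ℝ => K * ((1 + Real.log R) / R)) atTop (𝓝 0) := by
    have h1 : Tendsto (fun R : ℝ => Real.log R / R) atTop (𝓝 0) :=
      Real.isLittleO_log_id_atTop.tendsto_div_nhds_zero
    have h2 := (tendsto_inv_atTop_zero.add h1).const_mul K
    simp only [add_zero, mul_zero] at h2
    refine h2.congr fun R => ?_
    ring
  refine squeeze_zero_norm' ?_ (h0.comp hR)
  filter_upwards [hR.eventually_ge_atTop 2, eventually_gt_atTop 0] with T hRT hT
  have hpow : (T ^ ((8 : ℕ) : ℝ)⁻¹) ^ 8 = T := Real.rpow_inv_natCast_pow hT.le (by norm_num)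
  set R : ℝ := T ^ ((8 : ℕ) : ℝ)⁻¹ with hRdef
  have hR0 : 0 < R := by linarith
  have h := hK R hRT
  rw [hpow] at h
  have e1 : dampedMeanSq T / T - (2 * Real.log T + 2 * (meanConst - 1)) =
      (dampedMeanSq T - meanSqMain T) / T := by
    rw [meanSqMain]
    field_simp
  rw [e1, norm_div, Real.norm_eq_abs, Real.norm_of_nonneg hT.le, div_le_iff₀ hT]
  refine h.trans (le_of_eq ?_)
  simp only [Function.comp_apply]
  rw [← hRdef]
  calc K * (R ^ 7 * (1 + Real.log R)) = K * ((1 + Real.log R) / R) * R ^ 8 := by field_simp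
    _ = _ := by rw [hpow]

theorem norm_sq_riemannZeta_eq (t : ℝ) :
    ‖riemannZeta (1 / 2 + (t : ℂ) * Complex.I)‖ ^ 2 =
      zetaDensity t * t ^ 2 + zetaDensity t / 4 := by
  have h : ‖(1 / 2 + (t : ℂ) * Complex.I)‖ ^ 2 = 1 / 4 + t ^ 2 := by
    rw [← Complex.normSq_eq_norm_sq, ← half_add_mul_I_eq, Complex.normSq_add_mul_I]
    norm_num
  have h0 : (1 / 4 + t ^ 2 : ℝ) ≠ 0 := by positivity
  rw [zetaDensity, norm_div, div_pow, h]
  field_simp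
  ring

theorem intervalIntegrable_zetaDensity_mul_sq (a b : ℝ) :
    IntervalIntegrable (fun t => zetaDensity t * t ^ 2) volume a b :=
  integrable_zetaDensity.intervalIntegrable.mul_continuousOn (by fun_prop)

theorem logZetaIntegrand_eq (t : ℝ) :
    logZetaIntegrand t = Real.log t - (zetaDensity t * t ^ 2 + zetaDensity t / 4) := by
  rw [logZetaIntegrand, norm_sq_riemannZeta_eq]

theorem intervalIntegrable_logZetaIntegrand (a b : ℝ) :
    IntervalIntegrable logZetaIntegrand volume a b := by
  have h := (intervalIntegral.intervalIntegrable_log' (a := a) (b := b)).sub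
    ((intervalIntegrable_zetaDensity_mul_sq a b).add
      ((integrable_zetaDensity.intervalIntegrable (a := a) (b := b)).div_const 4))
  exact h.congr fun t _ => (logZetaIntegrand_eq t).symm

theorem logHardyLittlewood_eq (T : ℝ) :
    logHardyLittlewood T = T * Real.log T - T -
      (dampedMeanSq T / 2 + (∫ t in (0 : ℝ)..T, zetaDensity t) / 4) := by
  have hs : dampedMeanSq T = 2 * ∫ t in (0 : ℝ)..T, zetaDensity t * t ^ 2 := by
    have := intervalIntegral.integral_comp_neg (a := 0) (b := T) (fun t => zetaDensity t * t ^ 2)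
    simp only [zetaDensity_neg, neg_sq, neg_zero] at this
    rw [dampedMeanSq, ← intervalIntegral.integral_add_adjacent_intervals
      (intervalIntegrable_zetaDensity_mul_sq (-T) 0) (intervalIntegrable_zetaDensity_mul_sq 0 T),
      ← this]
    ring
  have hZ : IntervalIntegrable zetaDensity volume 0 T := integrable_zetaDensity.intervalIntegrable
  rw [logHardyLittlewood]
  simp_rw [logZetaIntegrand_eq]
  rw [intervalIntegral.integral_sub intervalIntegral.intervalIntegrable_log'
    ((intervalIntegrable_zetaDensity_mul_sq 0 T).add (hZ.div_const 4)),
    intervalIntegral.integral_add (intervalIntegrable_zetaDensity_mul_sq 0 T) (hZ.div_const 4),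
    intervalIntegral.integral_div, integral_log_from_zero, hs]
  ring

theorem tendsto_logHardyLittlewood_div :
    Tendsto (fun T : ℝ => logHardyLittlewood T / T) atTop (𝓝 (-meanConst)) := by
  have hZ : Tendsto (fun T : ℝ => (∫ t in (0 : ℝ)..T, zetaDensity t) / T) atTop (𝓝 0) :=
    (intervalIntegral_tendsto_integral_Ioi 0 integrable_zetaDensity.integrableOn
      tendsto_id).div_atTop tendsto_id
  have h := ((tendsto_dampedMeanSq_div.const_mul (-(1 / 2) : ℝ)).sub
    (hZ.const_mul (1 / 4 : ℝ))).add_const (-meanConst)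
  simp only [mul_zero, sub_zero, zero_add] at h
  refine h.congr' ?_
  filter_upwards [eventually_gt_atTop 0] with T hT
  rw [logHardyLittlewood_eq]
  field_simp
  ring

/-! ### The limit and Fermat's equation -/

/-- The sign ensures that `log (2π) - 2γ`, by which the statement divides, is positive. -/
theorem meanConst_neg : meanConst < 0 := by
  have h1 := Real.eulerMascheroniConstant_lt_two_thirds
  have h2 : (4 / 3 : ℝ) < Real.log (2 * Real.pi) := by
    rw [Real.lt_log_iff_exp_lt (by positivity)]
    have h4 : Real.exp (1 / 3) ≤ 3 / 2 := by
      have := Real.exp_bound' (x := 1 / 3) (by norm_num) (by norm_num) (n := 2) (by norm_num)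
      norm_num [Finset.sum_range_succ, Nat.factorial] at this
      linarith
    have h5 : Real.exp (4 / 3) = Real.exp 1 * Real.exp (1 / 3) := by
      rw [← Real.exp_add]; norm_num
    have h6 := Real.exp_one_lt_d9
    have h7 := Real.pi_gt_three
    rw [h5]
    nlinarith [Real.exp_pos 1, Real.exp_pos (1 / 3)]
  rw [meanConst]
  linarith

theorem hasL_self {q : ℝ} (hq : 0 < q) : HasL q q := by
  have hb : 0 < Real.log (2 * Real.pi) - 2 * Real.eulerMascheroniConstant := by
    have := meanConst_neg
    rw [meanConst] at this
    linarith
  have hbm : -meanConst = Real.log (2 * Real.pi) - 2 * Real.eulerMascheroniConstant := by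
    rw [meanConst]; ring
  unfold HasL normalizedLogHardyLittlewood
  set b : ℝ := Real.log (2 * Real.pi) - 2 * Real.eulerMascheroniConstant
  have hX : Tendsto (fun τ : ℝ => q * (τ / b)) atTop atTop :=
    (tendsto_id.atTop_div_const hb).const_mul_atTop hq
  have h := (tendsto_logHardyLittlewood_div.comp hX).const_mul (q / b)
  rw [hbm, div_mul_cancel₀ _ hb.ne'] at h
  refine h.congr' ?_
  filter_upwards [eventually_gt_atTop 0] with τ hτ
  simp only [Function.comp_apply]
  field_simp

theorem theorem1 :
    -- the integrals are genuine (convergent) integrals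
    (∀ T : ℝ, 0 < T → IntervalIntegrable logZetaIntegrand volume 0 T) ∧
    -- the limit `L(q)` exists and equals `q` for every `q > 0`
    (∀ q : ℝ, 0 < q → HasL q q) ∧
    -- `L ≠ 1` at all Fermat rationals if and only if Fermat's Last Theorem holds
    ((∀ x y z n : ℕ, 0 < x → 0 < y → 0 < z → 3 ≤ n →
        ∃ l : ℝ, HasL (((x : ℝ) ^ n + (y : ℝ) ^ n) / (z : ℝ) ^ n) l ∧ l ≠ 1) ↔
      (∀ x y z n : ℕ, 0 < x → 0 < y → 0 < z → 3 ≤ n → x ^ n + y ^ n ≠ z ^ n)) := by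
  refine ⟨fun T _ => intervalIntegrable_logZetaIntegrand 0 T, fun q hq => hasL_self hq, ?_, ?_⟩
  · intro h x y z n hx hy hz hn heq
    obtain ⟨l, hl, hl1⟩ := h x y z n hx hy hz hn
    have hz0 : (z : ℝ) ^ n ≠ 0 := by positivity
    have hone : ((x : ℝ) ^ n + (y : ℝ) ^ n) / (z : ℝ) ^ n = 1 := by
      rw [div_eq_one_iff_eq hz0]
      exact_mod_cast heq
    rw [hone] at hl
    exact hl1 (tendsto_nhds_unique hl (hasL_self one_pos))
  · intro h x y z n hx hy hz hn
    refine ⟨_, hasL_self (by positivity), fun hone => h x y z n hx hy hz hn ?_⟩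
    have hz0 : (z : ℝ) ^ n ≠ 0 := by positivity
    rw [div_eq_one_iff_eq hz0] at hone
    exact_mod_cast hone
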